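/- Let $n\ge 2$, let $K$ be a field of characteristic $0$, and let $f(x,y)=f_0x^n+f_1x^{n-1}y+\dots+f_ny^n\in K[x,y]$ be a binary form of degree $n$ whose discriminant is nonzero. (The discriminant of $\prod_{i=1}^n(\alpha_ix-\beta_iy)$ is $\prod_{i<j}(\alpha_i\beta_j-\alpha_j\beta_i)^2$.) Let $S_f\subset\mathbb{P}^1_K$ be the closed subscheme cut out by $f$, and put $L_f=H^0(S_f,\mathcal{O}_{S_f})$ and $I_f=H^0(S_f,\mathcal{O}_{S_f}(n-3))$. The connecting map of $$0\to\mathcal{O}_{\mathbb{P}^1}(-3)\xrightarrow{\ \times f\ }\mathcal{O}_{\mathbb{P}^1}(n-3)\to\mathcal{O}_{S_f}(n-3)\to0$$ is a map $I_f\to H^1(\mathbb{P}^1_K,\mathcal{O}(-3))$. For a linear form $a(x,y)$, let $\mathrm{ev}_a:I_f\to K$ be the composite $$I_f\to H^1(\mathbb{P}^1_K,\mathcal{O}(-3))\xrightarrow{\ \times a\ }H^1(\mathbb{P}^1_K,\mathcal{O}(-2))\cong K,$$ where the last isomorphism sends to $1$ the class of the Čech cocycle $(xy)^{-1}$ for the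 cover $D^+(y),D^+(x)$ (the connecting map being represented by the section over $D^+(y)$ minus the section over $D^+(x)$, divided by $f$). For a symmetric $n\times n$ matrix $A$ put $\mathrm{disc}(A)=(-1)^{n(n-1)/2}\det A$. Let $V_f(K)$ be the set of pairs $(A,B)$ of symmetric $n\times n$ matrices over $K$ with $\mathrm{disc}(xA-yB)=f(x,y)$; the group $\mathrm{SL}_n(K)$ acts on it by $g\cdot(A,B)=(g^{-t}Ag^{-1},\,g^{-t}Bg^{-1})$. An *$f$-module* is a triple $(M,\varphi,e)$, where $M$ is a free $L_f$-module of rank $1$, $\varphi:M\otimes_{L_f}M\to I_f$ is an isomorphism of $L_f$-modules, and $e\in\wedge^n_KM$ is a nonzero element, such that for every $K$-basis $\mathcal{B}=\{b_1,\dots,b_n\}$ of $M$ with $b_1\wedge\dots\wedge b_n=e$ the matrices $A_x,A_y$ of the $K$-bilinear forms $\mathrm{ev}_x\circ\varphi$, $\mathrm{ev}_y\circ\varphi$ on $M$ in the basis $\mathcal{B}$ satisfy $\mathrm{disc}(xA_y-yA_x)=f(x,y)$. An isomorphism $(M,\varphi,e)\to(M',\varphi',e')$ of $f$-modules is an $L_f$-linear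 isomorphism $\theta:M\to M'$ with $\varphi'\circ(\theta\otimes\theta)=\varphi$ and $(\wedge^n\theta)(e)=e'$. Then for every $f$-module $(M,\varphi,e)$ there is a $K$-basis $\mathcal{B}$ of $M$ with $b_1\wedge\dots\wedge b_n=e$; for each such basis, $A_x$ and $A_y$ are symmetric and $(A_y,A_x)\in V_f(K)$; the orbit $\mathrm{SL}_n(K)\cdot(A_y,A_x)$ depends only on the isomorphism class of $(M,\varphi,e)$; and the map $(M,\varphi,e)\mapsto \mathrm{SL}_n(K)\cdot(A_y,A_x)$ so defined is a bijection from the set of isomorphism classes of $f$-modules to the set of orbits $\mathrm{SL}_n(K)\backslash V_f(K)$. -/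

import Mathlib

open scoped TensorProduct

noncomputable section

namespace BinaryForm

universe u

variable {K : Type u} [Field K]

/-! ### Sections of `𝒪(k)` on the standard charts of the projective line -/

/-- `K[x^±1, y^±1]`; the coefficient at `(i, j)` is that of the monomial `x ^ i * y ^ j`.
Its part of degree `k` is the space of sections of `𝒪(k)` over `D⁺(xy)`. -/
abbrev Laurent (K : Type u) [Field K] : Type u := AddMonoidAlgebra K (ℤ × ℤ)

/-- Laurent polynomials that are homogeneous of total degree `k`. -/
def degreePart (K : Type u) [Field K] (k : ℤ) : Submodule K (Laurent K) :=
  AddMonoidAlgebra.supported K K {m : ℤ × ℤ | m.1 + m.2 = k}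

/-- Laurent polynomials all of whose exponents lie in an additive submonoid of `ℤ × ℤ`. -/
def supportedIn (K : Type u) [Field K] (S : AddSubmonoid (ℤ × ℤ)) :
    Subalgebra K (Laurent K) where
  carrier := {p | ∀ m, p.coeff m ≠ 0 → m ∈ S}
  mul_mem' := by
    classical
    intro p q hp hq m hm
    have h := AddMonoidAlgebra.support_coeff_mul_subset p q (Finsupp.mem_support_iff.mpr hm)
    obtain ⟨a, ha, b, hb, rfl⟩ := Finset.mem_add.mp h
    exact S.add_mem (hp a (Finsupp.mem_support_iff.mp ha)) (hq b (Finsupp.mem_support_iff.mp hb))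
  add_mem' := by
    intro p q hp hq m hm
    by_cases h : p.coeff m = 0
    · refine hq m fun h' => hm ?_
      simp [h, h']
    · exact hp m h
  algebraMap_mem' := by
    classical
    intro r m hm
    have : m = 0 := by
      by_contra h
      apply hm
      simp [AddMonoidAlgebra.coe_algebraMap, AddMonoidAlgebra.coeff_single, Ne.symm h]
    rw [this]
    exact S.zero_mem

/-- `K[x, y, y⁻¹]`; its part of degree `k` is the space of sections of `𝒪(k)` over `D⁺(y)`. -/
def chartY (K : Type u) [Field K] : Subalgebra K (Laurent K) :=
  supportedIn K ((AddSubmonoid.nonneg ℤ).comap (AddMonoidHom.fst ℤ ℤ))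

/-- `K[x, x⁻¹, y]`; its part of degree `k` is the space of sections of `𝒪(k)` over `D⁺(x)`. -/
def chartX (K : Type u) [Field K] : Subalgebra K (Laurent K) :=
  supportedIn K ((AddSubmonoid.nonneg ℤ).comap (AddMonoidHom.snd ℤ ℤ))

/-- The inclusion `K[x, y] → K[x^±1, y^±1]`; here `x` is `X 0` and `y` is `X 1`. -/
def toLaurent (K : Type u) [Field K] : MvPolynomial (Fin 2) K →ₐ[K] Laurent K :=
  MvPolynomial.aeval
    ![AddMonoidAlgebra.single ((1, 0) : ℤ × ℤ) 1, AddMonoidAlgebra.single ((0, 1) : ℤ × ℤ) 1]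

theorem single_mem_supportedIn {S : AddSubmonoid (ℤ × ℤ)} {m : ℤ × ℤ} (h : m ∈ S) (r : K) :
    AddMonoidAlgebra.single m r ∈ supportedIn K S := by
  classical
  intro m' hm'
  have : m' = m := by
    by_contra h'
    apply hm'
    simp [AddMonoidAlgebra.coeff_single, Ne.symm h']
  rwa [this]

theorem toLaurent_mem_supportedIn {S : AddSubmonoid (ℤ × ℤ)}
    (h1 : (1, 0) ∈ S) (h2 : (0, 1) ∈ S) (p : MvPolynomial (Fin 2) K) :
    toLaurent K p ∈ supportedIn K S := by
  induction p using MvPolynomial.induction_on with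
  | C a =>
    rw [toLaurent, MvPolynomial.aeval_C]
    exact (supportedIn K S).algebraMap_mem a
  | add p q hp hq => rw [map_add]; exact (supportedIn K S).add_mem hp hq
  | mul_X p i hp =>
    rw [map_mul]
    refine (supportedIn K S).mul_mem hp ?_
    rw [toLaurent, MvPolynomial.aeval_X]
    fin_cases i
    · exact single_mem_supportedIn h1 1
    · exact single_mem_supportedIn h2 1

/-- The inclusion `K[x, y] → K[x, y, y⁻¹]`. -/
def toChartY (K : Type u) [Field K] : MvPolynomial (Fin 2) K →ₐ[K] chartY K :=
  (toLaurent K).codRestrict (chartY K) fun p =>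
    toLaurent_mem_supportedIn (by simp) (by simp) p

/-- The inclusion `K[x, y] → K[x, x⁻¹, y]`. -/
def toChartX (K : Type u) [Field K] : MvPolynomial (Fin 2) K →ₐ[K] chartX K :=
  (toLaurent K).codRestrict (chartX K) fun p =>
    toLaurent_mem_supportedIn (by simp) (by simp) p

/-! ### The zero locus `S_f` of a form and the twists of its structure sheaf

`S_f` is covered by its intersections with `D⁺(y)` and `D⁺(x)`. The sections of `𝒪_{S_f}(k)` over
`S_f ∩ D⁺(y)`, `S_f ∩ D⁺(x)`, `S_f ∩ D⁺(xy)` are the degree `k` parts of the three rings below. -/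

variable (f : MvPolynomial (Fin 2) K)

/-- `K[x, y, y⁻¹] / (f)`. -/
def RingY : Type u := chartY K ⧸ Ideal.span {toChartY K f}

instance : CommRing (RingY f) := inferInstanceAs (CommRing (chartY K ⧸ Ideal.span {toChartY K f}))

instance : Algebra K (RingY f) := inferInstanceAs (Algebra K (chartY K ⧸ Ideal.span {toChartY K f}))

/-- The quotient map `K[x, y, y⁻¹] → K[x, y, y⁻¹] / (f)`. -/
def mkY : chartY K →ₐ[K] RingY f := Ideal.Quotient.mkₐ K (Ideal.span {toChartY K f})

/-- `K[x, x⁻¹, y] / (f)`. -/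
def RingX : Type u := chartX K ⧸ Ideal.span {toChartX K f}

instance : CommRing (RingX f) := inferInstanceAs (CommRing (chartX K ⧸ Ideal.span {toChartX K f}))

instance : Algebra K (RingX f) := inferInstanceAs (Algebra K (chartX K ⧸ Ideal.span {toChartX K f}))

/-- The quotient map `K[x, x⁻¹, y] → K[x, x⁻¹, y] / (f)`. -/
def mkX : chartX K →ₐ[K] RingX f := Ideal.Quotient.mkₐ K (Ideal.span {toChartX K f})

/-- `K[x^±1, y^±1] / (f)`. -/
def RingXY : Type u := Laurent K ⧸ Ideal.span {toLaurent K f}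

instance : CommRing (RingXY f) := inferInstanceAs (CommRing (Laurent K ⧸ Ideal.span {toLaurent K f}))

instance : Algebra K (RingXY f) := inferInstanceAs (Algebra K (Laurent K ⧸ Ideal.span {toLaurent K f}))

/-- The quotient map `K[x^±1, y^±1] → K[x^±1, y^±1] / (f)`. -/
def mkXY : Laurent K →ₐ[K] RingXY f := Ideal.Quotient.mkₐ K (Ideal.span {toLaurent K f})

/-- Restriction of sections from `D⁺(y)` to `D⁺(xy)`. -/
def resY : RingY f →ₐ[K] RingXY f :=
  Ideal.quotientMapₐ (Ideal.span {toLaurent K f}) (chartY K).val <| by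
    rw [Ideal.span_singleton_le_iff_mem]
    exact Ideal.mem_span_singleton_self _

/-- Restriction of sections from `D⁺(x)` to `D⁺(xy)`. -/
def resX : RingX f →ₐ[K] RingXY f :=
  Ideal.quotientMapₐ (Ideal.span {toLaurent K f}) (chartX K).val <| by
    rw [Ideal.span_singleton_le_iff_mem]
    exact Ideal.mem_span_singleton_self _

/-- The pair `(p, q)`, with `p` in `K[x, y, y⁻¹]` and `q` in `K[x, x⁻¹, y]` homogeneous of degree
`k`, represents the pair of local sections `s` of `𝒪_{S_f}(k)`. -/
def IsLift (k : ℤ) (s : RingY f × RingX f) (p : chartY K) (q : chartX K) : Prop :=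
  (p : Laurent K) ∈ degreePart K k ∧ (q : Laurent K) ∈ degreePart K k ∧
    mkY f p = s.1 ∧ mkX f q = s.2

/-- `H⁰(S_f, 𝒪_{S_f}(k))`: pairs of sections of `𝒪_{S_f}(k)` over `S_f ∩ D⁺(y)` and over
`S_f ∩ D⁺(x)` that agree on `S_f ∩ D⁺(xy)`. -/
def H0 (k : ℤ) : Submodule K (RingY f × RingX f) where
  carrier := {s | (∃ p q, IsLift f k s p q) ∧ resY f s.1 = resX f s.2}
  add_mem' := by
    rintro s t ⟨⟨p, q, hp, hq, h1, h2⟩, h⟩ ⟨⟨p', q', hp', hq', h1', h2'⟩, h'⟩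
    refine ⟨⟨p + p', q + q', Submodule.add_mem _ hp hp', Submodule.add_mem _ hq hq', ?_, ?_⟩, ?_⟩
    · simp [h1, h1']
    · simp [h2, h2']
    · simp [h, h']
  zero_mem' := ⟨⟨0, 0, Submodule.zero_mem _, Submodule.zero_mem _, by simp, by simp⟩, by simp⟩
  smul_mem' := by
    rintro c s ⟨⟨p, q, hp, hq, h1, h2⟩, h⟩
    refine ⟨⟨c • p, c • q, Submodule.smul_mem _ c hp, Submodule.smul_mem _ c hq, ?_, ?_⟩, ?_⟩
    · simp [h1]
    · simp [h2]
    · simp [h]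

theorem mul_mem_degreePart {k l : ℤ} {p q : Laurent K} (hp : p ∈ degreePart K k)
    (hq : q ∈ degreePart K l) : p * q ∈ degreePart K (k + l) := by
  classical
  intro m hm
  have h := AddMonoidAlgebra.support_coeff_mul_subset p q hm
  obtain ⟨a, ha, b, hb, rfl⟩ := Finset.mem_add.mp h
  have ha' : a.1 + a.2 = k := hp ha
  have hb' : b.1 + b.2 = l := hq hb
  simp only [Set.mem_ofPred_eq, Prod.fst_add, Prod.snd_add]
  omega

theorem algebraMap_mem_degreePart (r : K) : algebraMap K (Laurent K) r ∈ degreePart K 0 := by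
  classical
  intro m hm
  have : m = 0 := by
    by_contra h
    apply Finsupp.mem_support_iff.mp hm
    simp [AddMonoidAlgebra.coe_algebraMap, AddMonoidAlgebra.coeff_single, Ne.symm h]
  simp [this]

theorem mul_mem_H0 {k l : ℤ} {s t : RingY f × RingX f} (hs : s ∈ H0 f k) (ht : t ∈ H0 f l) :
    s * t ∈ H0 f (k + l) := by
  obtain ⟨⟨p, q, hp, hq, h1, h2⟩, h⟩ := hs
  obtain ⟨⟨p', q', hp', hq', h1', h2'⟩, h'⟩ := ht
  refine ⟨⟨p * p', q * q', mul_mem_degreePart hp hp', mul_mem_degreePart hq hq', ?_, ?_⟩, ?_⟩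
  · simp [h1, h1']
  · simp [h2, h2']
  · simp [h, h']

/-- The `K`-algebra `L_f = H⁰(S_f, 𝒪_{S_f})`. -/
def L : Subalgebra K (RingY f × RingX f) where
  carrier := H0 f 0
  mul_mem' {s t} hs ht := by
    have h : s * t ∈ H0 f (0 + 0) := mul_mem_H0 f hs ht
    rwa [add_zero] at h
  add_mem' hs ht := (H0 f 0).add_mem hs ht
  algebraMap_mem' r :=
    ⟨⟨algebraMap K _ r, algebraMap K _ r, algebraMap_mem_degreePart r,
      algebraMap_mem_degreePart r, (mkY f).commutes r, (mkX f).commutes r⟩, by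
        rw [Prod.algebraMap_apply, AlgHom.commutes, AlgHom.commutes]⟩

/-- `H⁰(S_f, 𝒪_{S_f}(k))` as an `L_f`-module. -/
def twist (k : ℤ) : Submodule (L f) (RingY f × RingX f) where
  carrier := H0 f k
  add_mem' hs ht := (H0 f k).add_mem hs ht
  zero_mem' := (H0 f k).zero_mem
  smul_mem' c s hs := by
    have h := mul_mem_H0 f c.2 hs
    rwa [zero_add] at h

/-- The `L_f`-module `I_f = H⁰(S_f, 𝒪_{S_f}(n - 3))`, for a form `f` of degree `n`. -/
abbrev I (n : ℕ) : Submodule (L f) (RingY f × RingX f) := twist f ((n : ℤ) - 3)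

/-! ### The connecting map and the functionals `ev_a` -/

/-- The Laurent polynomial `c` is a Čech cocycle representing the image of the section `s` under
the connecting map `H⁰(S_f, 𝒪_{S_f}(k)) → H¹(ℙ¹, 𝒪(k - n))` of
`0 → 𝒪(k - n) → 𝒪(k) → 𝒪_{S_f}(k) → 0`, where the first map is multiplication by `f`. -/
def IsConnecting (k : ℤ) (s : RingY f × RingX f) (c : Laurent K) : Prop :=
  ∃ p q, IsLift f k s p q ∧ (p : Laurent K) - q = toLaurent K f * c

theorem exists_isConnecting {k : ℤ} {s : RingY f × RingX f} (hs : s ∈ twist f k) :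
    ∃ c, IsConnecting f k s c := by
  obtain ⟨⟨p, q, hl⟩, h⟩ := hs
  have h3 : (p : Laurent K) - q ∈ Ideal.span {toLaurent K f} := by
    rw [← hl.2.2.1, ← hl.2.2.2] at h
    exact Ideal.Quotient.eq.mp h
  obtain ⟨c, hc⟩ := Ideal.mem_span_singleton'.mp h3
  exact ⟨c, p, q, hl, by rw [← hc, mul_comm]⟩

/-- `ev_a : I_f → K` for a form `a` in `K[x, y]` (of degree one): the connecting map
`I_f → H¹(ℙ¹, 𝒪(-3))`, then multiplication by `a` to `H¹(ℙ¹, 𝒪(-2))`, then the isomorphism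
`H¹(ℙ¹, 𝒪(-2)) ≅ K` sending the class of the cocycle `(xy)⁻¹` to `1`. In terms of cocycles the
latter reads off the coefficient of `x⁻¹ y⁻¹`, since all other monomials of degree `-2` extend to
`D⁺(x)` or to `D⁺(y)`. See `ev_eq` for the independence of the chosen cocycle. -/
def ev {n : ℕ} (a : MvPolynomial (Fin 2) K) (s : I f n) : K :=
  (toLaurent K a * (exists_isConnecting f s.2).choose).coeff (-1, -1)

theorem toLaurent_injective : Function.Injective (toLaurent K) := by
  let g : (Fin 2 →₀ ℕ) →+ ℤ × ℤ :=
    AddMonoidHom.mk' (fun m => ((m 0 : ℤ), (m 1 : ℤ))) (by intro a b; simp)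
  have hg : Function.Injective g := by
    intro a b h
    have h0 : (a 0 : ℤ) = b 0 := congrArg Prod.fst h
    have h1 : (a 1 : ℤ) = b 1 := congrArg Prod.snd h
    ext i
    fin_cases i
    · exact_mod_cast h0
    · exact_mod_cast h1
  let G : MvPolynomial (Fin 2) K →ₐ[K] Laurent K := AddMonoidAlgebra.mapDomainAlgHom K K g
  have h : toLaurent K = G := by
    refine MvPolynomial.algHom_ext fun i => ?_
    have h1 : G (MvPolynomial.X i) = AddMonoidAlgebra.single (g (Finsupp.single i 1)) 1 :=
      AddMonoidAlgebra.mapDomain_single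
    rw [h1, toLaurent, MvPolynomial.aeval_X]
    fin_cases i <;> simp [g]
  rw [h]
  exact AddMonoidAlgebra.mapDomain_injective hg

theorem ev_eq {n : ℕ} (hf : f ≠ 0) (a : MvPolynomial (Fin 2) K) (s : I f n) {c : Laurent K}
    (hc : IsConnecting f ((n : ℤ) - 3) s c) :
    ev f a s = (toLaurent K a * c).coeff (-1, -1) := by
  have hF : toLaurent K f ≠ 0 := (map_ne_zero_iff _ toLaurent_injective).mpr hf
  obtain ⟨p, q, ⟨-, -, hp, hq⟩, hpq⟩ := hc
  obtain ⟨p', q', ⟨-, -, hp', hq'⟩, hpq'⟩ := (exists_isConnecting f s.2).choose_spec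
  set c' := (exists_isConnecting f s.2).choose with hc'
  obtain ⟨b, hb⟩ := Ideal.mem_span_singleton.mp (Ideal.Quotient.eq.mp (hp'.trans hp.symm))
  obtain ⟨d, hd⟩ := Ideal.mem_span_singleton.mp (Ideal.Quotient.eq.mp (hq'.trans hq.symm))
  have hb' : (p' : Laurent K) - p = toLaurent K f * b := congrArg Subtype.val hb
  have hd' : (q' : Laurent K) - q = toLaurent K f * d := congrArg Subtype.val hd
  have hcc : c' = c + b - d := by
    apply mul_left_cancel₀ hF
    rw [mul_sub, mul_add, ← hpq, ← hpq', ← hb', ← hd']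
    ring
  have h1 : (toLaurent K a * (b : Laurent K)).coeff (-1, -1) = 0 := by
    by_contra h
    have h2 := (toChartY K a * b).2 _ h
    simp at h2
  have h2 : (toLaurent K a * (d : Laurent K)).coeff (-1, -1) = 0 := by
    by_contra h
    have h2 := (toChartX K a * d).2 _ h
    simp at h2
  have h3 : ev f a s = (toLaurent K a * c').coeff (-1, -1) := rfl
  rw [h3, hcc, mul_sub, mul_add]
  simp [h1, h2]

/-! ### Discriminants and pairs of symmetric matrices -/

/-- The discriminant of the binary form `f` of degree `n` is nonzero: over an algebraic closure,
`f = ∏ (α i * x - β i * y)` with `∏_{i < j} (α i * β j - α j * β i) ^ 2 ≠ 0`. -/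
def DiscrNeZero (n : ℕ) : Prop :=
  ∃ α β : Fin n → AlgebraicClosure K,
    MvPolynomial.map (algebraMap K (AlgebraicClosure K)) f =
        ∏ i, (MvPolynomial.C (α i) * MvPolynomial.X 0 - MvPolynomial.C (β i) * MvPolynomial.X 1) ∧
      ∏ i, ∏ j ∈ Finset.Ioi i, (α i * β j - α j * β i) ^ 2 ≠ 0

/-- The invariant form `f_{A,B}(x, y) = disc(x A - y B)`, where
`disc(M) = (-1) ^ (n (n - 1) / 2) * det(M)`. -/
def invariantForm {n : ℕ} (A B : Matrix (Fin n) (Fin n) K) : MvPolynomial (Fin 2) K :=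
  (-1) ^ (n * (n - 1) / 2) *
    Matrix.det ((MvPolynomial.X 0 : MvPolynomial (Fin 2) K) • A.map MvPolynomial.C -
      (MvPolynomial.X 1 : MvPolynomial (Fin 2) K) • B.map MvPolynomial.C)

/-- `V(K)`: pairs of symmetric `n × n` matrices. -/
abbrev SymPair (K : Type u) [Field K] (n : ℕ) : Type u :=
  {v : Matrix (Fin n) (Fin n) K × Matrix (Fin n) (Fin n) K // v.1.IsSymm ∧ v.2.IsSymm}

/-- The action `g • (A, B) = (g⁻ᵀ A g⁻¹, g⁻ᵀ B g⁻¹)` of `SL_n(K)` on `V(K)`. -/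
instance symPairAction (n : ℕ) :
    MulAction (Matrix.SpecialLinearGroup (Fin n) K) (SymPair K n) where
  smul g v :=
    ⟨((g⁻¹).1.transpose * v.1.1 * (g⁻¹).1, (g⁻¹).1.transpose * v.1.2 * (g⁻¹).1), by
      constructor
      · simp only [Matrix.IsSymm, Matrix.transpose_mul, Matrix.transpose_transpose, v.2.1.eq,
          Matrix.mul_assoc]
      · simp only [Matrix.IsSymm, Matrix.transpose_mul, Matrix.transpose_transpose, v.2.2.eq,
          Matrix.mul_assoc]⟩
  one_smul v := by
    apply Subtype.ext
    change (_, _) = _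
    simp
  mul_smul g h v := by
    apply Subtype.ext
    change (((g * h)⁻¹).1.transpose * v.1.1 * ((g * h)⁻¹).1,
        ((g * h)⁻¹).1.transpose * v.1.2 * ((g * h)⁻¹).1) =
      ((g⁻¹).1.transpose * ((h⁻¹).1.transpose * v.1.1 * (h⁻¹).1) * (g⁻¹).1,
        (g⁻¹).1.transpose * ((h⁻¹).1.transpose * v.1.2 * (h⁻¹).1) * (g⁻¹).1)
    have e : ((g * h)⁻¹).1 = (h⁻¹).1 * (g⁻¹).1 := by
      rw [mul_inv_rev]; rfl
    simp only [e, Matrix.transpose_mul, Matrix.mul_assoc]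

theorem invariantForm_conj {n : ℕ} (A B g : Matrix (Fin n) (Fin n) K) (hg : g.det = 1) :
    invariantForm (g.transpose * A * g) (g.transpose * B * g) = invariantForm A B := by
  unfold invariantForm
  congr 1
  have e : (MvPolynomial.X 0 : MvPolynomial (Fin 2) K) •
        (g.transpose * A * g).map (MvPolynomial.C : K →+* MvPolynomial (Fin 2) K) -
      (MvPolynomial.X 1 : MvPolynomial (Fin 2) K) •
        (g.transpose * B * g).map (MvPolynomial.C : K →+* MvPolynomial (Fin 2) K) =
      (g.map (MvPolynomial.C : K →+* MvPolynomial (Fin 2) K)).transpose *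
        ((MvPolynomial.X 0 : MvPolynomial (Fin 2) K) • A.map MvPolynomial.C -
          (MvPolynomial.X 1 : MvPolynomial (Fin 2) K) • B.map MvPolynomial.C) *
        g.map (MvPolynomial.C : K →+* MvPolynomial (Fin 2) K) := by
    simp only [Matrix.map_mul, Matrix.mul_sub, Matrix.sub_mul, Matrix.mul_smul, Matrix.smul_mul,
      Matrix.transpose_map]
  have d : (g.map (MvPolynomial.C : K →+* MvPolynomial (Fin 2) K)).det = 1 := by
    have := (RingHom.map_det (MvPolynomial.C : K →+* MvPolynomial (Fin 2) K) g).symm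
    rwa [hg, map_one] at this
  exact (congrArg Matrix.det e).trans (by
    rw [Matrix.det_mul, Matrix.det_mul, Matrix.det_transpose, d, one_mul, mul_one])

/-- `V_f(K)`, the `SL_n(K)`-stable set of pairs `(A, B)` in `V(K)` with `f_{A,B} = f`. -/
def Vf (n : ℕ) : SubMulAction (Matrix.SpecialLinearGroup (Fin n) K) (SymPair K n) where
  carrier := {v | invariantForm v.1.1 v.1.2 = f}
  smul_mem' g _ hv := (invariantForm_conj _ _ _ (g⁻¹).2).trans hv

/-- The set of orbits `SL_n(K) \ V_f(K)`. -/
abbrev Orbits (n : ℕ) : Type u :=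
  MulAction.orbitRel.Quotient (Matrix.SpecialLinearGroup (Fin n) K) (Vf f n)

/-! ### `f`-modules -/

/-- The Gram matrix `(ev_a (φ (b i ⊗ b j)))` with respect to a basis `b`. -/
def gram {n : ℕ} {M : Type u} [AddCommGroup M] [Module K M] [Module (L f) M]
    (φ : M ⊗[L f] M ≃ₗ[L f] I f n) (b : Module.Basis (Fin n) K M)
    (a : MvPolynomial (Fin 2) K) : Matrix (Fin n) (Fin n) K :=
  Matrix.of fun i j => ev f a (φ (b i ⊗ₜ[L f] b j))

/-- An `f`-module `(M, φ, e)`, for a binary form `f` of degree `n`. -/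
structure FModule (n : ℕ) where
  M : Type u
  [addCommGroup : AddCommGroup M]
  [module : Module K M]
  [moduleL : Module (L f) M]
  [isScalarTower : IsScalarTower K (L f) M]
  free : Module.Free (L f) M
  rank_eq_one : Module.finrank (L f) M = 1
  φ : M ⊗[L f] M ≃ₗ[L f] I f n
  e : ⋀[K]^n M
  e_ne_zero : e ≠ 0
  /-- `disc(x A_y - y A_x) = f` in every basis `b` with `b 1 ∧ ⋯ ∧ b n = e`. -/
  disc_eq : ∀ b : Module.Basis (Fin n) K M, exteriorPower.ιMulti K n b = e →
    invariantForm (gram f φ b (MvPolynomial.X 1)) (gram f φ b (MvPolynomial.X 0)) = f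

attribute [instance] FModule.addCommGroup FModule.module FModule.moduleL FModule.isScalarTower

variable {f}

/-- Two `f`-modules are isomorphic: there is an `L_f`-linear isomorphism of the underlying modules
that is compatible with the maps `φ` and with the elements `e`. -/
def FModule.IsIso {n : ℕ} (P Q : FModule f n) : Prop :=
  ∃ θ : P.M ≃ₗ[L f] Q.M,
    (∀ u v : P.M, Q.φ (θ u ⊗ₜ[L f] θ v) = P.φ (u ⊗ₜ[L f] v)) ∧
      exteriorPower.map n (θ.toLinearMap.restrictScalars K) P.e = Q.e

/-- Isomorphism of `f`-modules is an equivalence relation. -/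
def FModule.isoSetoid (f : MvPolynomial (Fin 2) K) (n : ℕ) : Setoid (FModule f n) where
  r := FModule.IsIso
  iseqv :=
    { refl := fun P => ⟨LinearEquiv.refl _ _, fun _ _ => rfl, by
        change exteriorPower.map n LinearMap.id P.e = P.e
        rw [exteriorPower.map_id]; rfl⟩
      symm := by
        rintro P Q ⟨θ, h1, h2⟩
        refine ⟨θ.symm, fun u v => ?_, ?_⟩
        · rw [← h1, θ.apply_symm_apply, θ.apply_symm_apply]
        · rw [← h2, ← LinearMap.comp_apply, ← exteriorPower.map_comp]
          have : (θ.symm.toLinearMap.restrictScalars K) ∘ₗ (θ.toLinearMap.restrictScalars K) =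
              LinearMap.id := by
            ext u; simp
          rw [this, exteriorPower.map_id]; rfl
      trans := by
        rintro P Q R ⟨θ, h1, h2⟩ ⟨η, h3, h4⟩
        refine ⟨θ.trans η, fun u v => ?_, ?_⟩
        · rw [← h1, ← h3]; rfl
        · rw [← h4, ← h2, ← LinearMap.comp_apply, ← exteriorPower.map_comp]; rfl }

/-- The set of isomorphism classes of `f`-modules. -/
def FModule.IsoClass (f : MvPolynomial (Fin 2) K) (n : ℕ) : Type (u + 1) :=
  Quotient (FModule.isoSetoid f n)

/-- The isomorphism class of an `f`-module. -/
def FModule.isoClass {n : ℕ} (P : FModule f n) : FModule.IsoClass f n :=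
  Quotient.mk (FModule.isoSetoid f n) P

/-- The `SL_n(K)`-orbit of an element of `V_f(K)`. -/
def Vf.orbit {n : ℕ} (v : Vf f n) : Orbits f n := Quotient.mk _ v

/-- `A_x`, the matrix of `ev_x ∘ φ` in the basis `b`. -/
def FModule.Ax {n : ℕ} (P : FModule f n) (b : Module.Basis (Fin n) K P.M) :
    Matrix (Fin n) (Fin n) K := gram f P.φ b (MvPolynomial.X 0)

/-- `A_y`, the matrix of `ev_y ∘ φ` in the basis `b`. -/
def FModule.Ay {n : ℕ} (P : FModule f n) (b : Module.Basis (Fin n) K P.M) :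
    Matrix (Fin n) (Fin n) K := gram f P.φ b (MvPolynomial.X 1)

end BinaryForm

end

/-! Since `K` is infinite, some linear form a = x + ty has no zero on S_f. Its powers trivialize
every 𝒪_{S_f}(k): with θ = y/a one gets L_f = K[θ]/(g), where g(z) = f(1 - tz, z) has degree n, and
I_f = L_f·w with w = a^(n-3). Put ρ(l) = ev_a(l w), the residue of l a^(n-2). It kills θ^i for i ≤
n-2, because θ^i a^(n-2) is then the restriction of a form on ℙ¹. It is not zero, because H¹(ℙ¹,
𝒪(n-2)) = 0, so ρ(θ^(n-1)) ≠ 0. Hence the pairing ρ(l l') is nondegenerate (`eq_zero_of_ρ_mul`).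

Up to the volume e, an f-module is thus a nondegenerate symmetric form C = ev_a ∘ φ with a
C-self-adjoint operator θ: A_x + t A_y is the Gram matrix of C, and A_y that of C(θu, v). The pair
determines C, then θ, then the L_f-structure and φ; this gives injectivity (`isIso_of_gram_eq`).

Conversely, (A, B) in V_f gives C = B + tA, with det C = ±f(-t, 1) ≠ 0, and N = C⁻¹A, whose
characteristic polynomial is proportional to g. Letting θ act by N makes K^n an L_f-module. The
nonzero discriminant makes g separable, so N has a cyclic vector (`exists_cyclic_vector`) and the
module is free of rank 1. As A and C are symmetric, C is L_f-balanced, and nondegeneracy of ρ turns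
it into φ (`exists_φ`). -/

noncomputable section

namespace BinaryForm

universe u

/-! ### Graded Laurent polynomials and the cohomology of 𝒪(k) on ℙ¹. -/

variable {K : Type u} [Field K]

open scoped Classical in
/-- The part of a Laurent polynomial supported in a set of exponents. -/
def restrictTo (S : Set (ℤ × ℤ)) : Laurent K →ₗ[K] Laurent K where
  toFun c := .ofCoeff (c.coeff.filter (· ∈ S))
  map_add' c d := by ext; simp [Finsupp.filter_add]
  map_smul' r c := by ext; simp [Finsupp.filter_smul]

open scoped Classical in
theorem coeff_restrictTo (S : Set (ℤ × ℤ)) (c : Laurent K) (m : ℤ × ℤ) :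
    (restrictTo S c).coeff m = if m ∈ S then c.coeff m else 0 := by
  simp [restrictTo, Finsupp.filter_apply]

theorem mem_degreePart {k : ℤ} {p : Laurent K} :
    p ∈ degreePart K k ↔ ∀ m : ℤ × ℤ, p.coeff m ≠ 0 → m.1 + m.2 = k := by
  rw [degreePart, AddMonoidAlgebra.mem_supported']
  refine forall_congr' fun m => ?_
  rw [Set.mem_ofPred_eq, not_imp_comm]

theorem toLaurent_monomial (m : Fin 2 →₀ ℕ) (r : K) :
    toLaurent K (MvPolynomial.monomial m r) =
      AddMonoidAlgebra.single ((m 0 : ℤ), (m 1 : ℤ)) r := by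
  rw [toLaurent, MvPolynomial.aeval_monomial, Finsupp.prod_fintype _ _ (by simp)]
  simp [Fin.prod_univ_two, AddMonoidAlgebra.single_pow, AddMonoidAlgebra.single_mul_single,
    AddMonoidAlgebra.coe_algebraMap]

theorem toLaurent_mem_degreePart {k : ℕ} {p : MvPolynomial (Fin 2) K} (hp : p.IsHomogeneous k) :
    toLaurent K p ∈ degreePart K k := by
  rw [p.as_sum, map_sum]
  refine Submodule.sum_mem _ fun m hm => ?_
  rw [toLaurent_monomial, mem_degreePart]
  intro m' hm'
  have : m' = ((m 0 : ℤ), (m 1 : ℤ)) := by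
    by_contra h
    exact hm' (by simp [AddMonoidAlgebra.coeff_single, Ne.symm h])
  subst this
  have := hp (MvPolynomial.mem_support_iff.mp hm)
  rw [Finsupp.weight_apply, Finsupp.sum_fintype _ _ (by simp)] at this
  simp [Fin.sum_univ_two] at this
  simp only
  omega

theorem restrictTo_mem_degreePart {k : ℤ} {c : Laurent K} (hc : c ∈ degreePart K k)
    (S : Set (ℤ × ℤ)) : restrictTo S c ∈ degreePart K k := by
  rw [mem_degreePart] at hc ⊢
  intro m hm
  rw [coeff_restrictTo] at hm
  exact hc m fun h => hm (by simp [h])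

theorem restrictTo_degree_mem_degreePart (k : ℤ) (c : Laurent K) :
    restrictTo {m : ℤ × ℤ | m.1 + m.2 = k} c ∈ degreePart K k := by
  rw [mem_degreePart]
  intro m hm
  rw [coeff_restrictTo] at hm
  by_contra h
  exact hm (if_neg h)

theorem restrictTo_degree_eq_self {k : ℤ} {c : Laurent K} (hc : c ∈ degreePart K k) :
    restrictTo {m : ℤ × ℤ | m.1 + m.2 = k} c = c := by
  rw [mem_degreePart] at hc
  ext m
  rw [coeff_restrictTo]
  split_ifs with h
  · rfl
  · by_contra h'
    exact h (hc m (Ne.symm h'))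

theorem restrictTo_mem_supportedIn {T : AddSubmonoid (ℤ × ℤ)} {c : Laurent K}
    (hc : c ∈ supportedIn K T) (S : Set (ℤ × ℤ)) : restrictTo S c ∈ supportedIn K T := by
  intro m hm
  rw [coeff_restrictTo] at hm
  exact hc m fun h => hm (by simp [h])

/-- Quotients by `f` obtained from ideal membership carry no degree. This allows them to be replaced
by a homogeneous component; by linearity in `F`, monomials suffice. -/
theorem restrictTo_degree_mul {k n : ℤ} {F : Laurent K} (hF : F ∈ degreePart K n) (c : Laurent K) :
    restrictTo {m : ℤ × ℤ | m.1 + m.2 = n + k} (F * c) =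
      F * restrictTo {m : ℤ × ℤ | m.1 + m.2 = k} c := by
  rw [degreePart, AddMonoidAlgebra.supported_eq_span_single] at hF
  induction hF using Submodule.span_induction with
  | mem F hF =>
    obtain ⟨m, hm, rfl⟩ := hF
    rw [Set.mem_ofPred_eq] at hm
    ext m'
    rw [coeff_restrictTo, AddMonoidAlgebra.coeff_single_mul_apply,
      AddMonoidAlgebra.coeff_single_mul_apply, coeff_restrictTo]
    have : m' ∈ {m : ℤ × ℤ | m.1 + m.2 = n + k} ↔ -m + m' ∈ {m : ℤ × ℤ | m.1 + m.2 = k} := by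
      simp only [Set.mem_ofPred_eq, Prod.fst_add, Prod.snd_add, Prod.fst_neg, Prod.snd_neg]
      omega
    simp [this]
  | zero => simp
  | add F G _ _ hF hG => rw [add_mul, map_add, hF, hG, add_mul]
  | smul r F _ hF => rw [smul_mul_assoc, map_smul, hF, smul_mul_assoc]

/-- `H¹(ℙ¹, 𝒪(k)) = 0` for `k ≥ -1`. -/
theorem exists_sub_eq_of_mem_degreePart {k : ℤ} (hk : -1 ≤ k) {c : Laurent K}
    (hc : c ∈ degreePart K k) :
    ∃ (p : chartY K) (q : chartX K), (p : Laurent K) ∈ degreePart K k ∧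
      (q : Laurent K) ∈ degreePart K k ∧ (p : Laurent K) - q = c := by
  -- Split by the sign of the exponent of x: if it is negative, then degree k ≥ -1 forces the
  -- exponent of y to be nonnegative.
  refine ⟨⟨restrictTo {m | 0 ≤ m.1} c, ?_⟩, ⟨-restrictTo {m | m.1 < 0} c, ?_⟩,
    restrictTo_mem_degreePart hc _, Submodule.neg_mem _ (restrictTo_mem_degreePart hc _), ?_⟩
  · intro m hm
    rw [coeff_restrictTo] at hm
    by_contra h
    exact hm (if_neg h)
  · refine (chartX K).neg_mem ?_
    intro m hm
    rw [coeff_restrictTo] at hm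
    have h1 : m.1 < 0 := by
      by_contra h
      exact hm (if_neg h)
    have h2 := mem_degreePart.mp hc m fun h => hm (by simp [h])
    change 0 ≤ m.2
    omega
  · ext m
    simp only [sub_neg_eq_add, AddMonoidAlgebra.coeff_add, Finsupp.add_apply, coeff_restrictTo,
      Set.mem_ofPred_eq]
    by_cases h : 0 ≤ m.1
    · simp [h, not_lt.mpr h]
    · simp [h, not_le.mp h]

/-- `H⁰(ℙ¹, 𝒪(k))` consists of the forms of degree `k`. -/
theorem exists_toLaurent_eq {k : ℕ} {c : Laurent K} (hc : c ∈ degreePart K k)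
    (hY : c ∈ chartY K) (hX : c ∈ chartX K) :
    ∃ P : MvPolynomial (Fin 2) K, P.IsHomogeneous k ∧ toLaurent K P = c := by
  have h1 : ∀ m ∈ c.coeff.support, 0 ≤ m.1 := fun m hm => hY m (Finsupp.mem_support_iff.mp hm)
  have h2 : ∀ m ∈ c.coeff.support, 0 ≤ m.2 := fun m hm => hX m (Finsupp.mem_support_iff.mp hm)
  have h3 := mem_degreePart.mp hc
  refine ⟨∑ m ∈ c.coeff.support, MvPolynomial.monomial
    (Finsupp.equivFunOnFinite.symm ![m.1.toNat, m.2.toNat]) (c.coeff m), ?_, ?_⟩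
  · refine MvPolynomial.IsHomogeneous.sum _ _ _ fun m hm => MvPolynomial.isHomogeneous_monomial _ ?_
    rw [Finsupp.degree_eq_sum]
    have := h1 m hm
    have := h2 m hm
    have := h3 m (Finsupp.mem_support_iff.mp hm)
    simp [Fin.sum_univ_two]
    omega
  · rw [map_sum]
    conv_rhs => rw [← AddMonoidAlgebra.sum_coeff_single c, Finsupp.sum]
    refine Finset.sum_congr rfl fun m hm => ?_
    rw [toLaurent_monomial]
    simp [h1 m hm, h2 m hm]

/-! ### Restricting forms from ℙ¹ to S_f. -/

variable {f : MvPolynomial (Fin 2) K}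

variable (f) in
/-- The pair of restrictions to the two charts of `S_f` of a polynomial in `x` and `y`. -/
def ofForm : MvPolynomial (Fin 2) K →ₐ[K] RingY f × RingX f :=
  ((mkY f).comp (toChartY K)).prod ((mkX f).comp (toChartX K))

theorem isLift_ofForm {k : ℕ} {P : MvPolynomial (Fin 2) K} (hP : P.IsHomogeneous k) :
    IsLift f k (ofForm f P) (toChartY K P) (toChartX K P) :=
  ⟨toLaurent_mem_degreePart hP, toLaurent_mem_degreePart hP, rfl, rfl⟩

theorem ofForm_mem_H0 {k : ℕ} {P : MvPolynomial (Fin 2) K} (hP : P.IsHomogeneous k) :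
    ofForm f P ∈ H0 f k :=
  ⟨⟨_, _, isLift_ofForm hP⟩, rfl⟩

theorem ofForm_self : ofForm f f = 0 :=
  Prod.ext (Ideal.Quotient.eq_zero_iff_mem.mpr (Ideal.mem_span_singleton_self _))
    (Ideal.Quotient.eq_zero_iff_mem.mpr (Ideal.mem_span_singleton_self _))

theorem mkY_mul_self (p : chartY K) : mkY f (toChartY K f * p) = 0 :=
  Ideal.Quotient.eq_zero_iff_mem.mpr (Ideal.mul_mem_right _ _ (Ideal.mem_span_singleton_self _))

theorem mkX_mul_self (p : chartX K) : mkX f (toChartX K f * p) = 0 :=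
  Ideal.Quotient.eq_zero_iff_mem.mpr (Ideal.mul_mem_right _ _ (Ideal.mem_span_singleton_self _))

/-- `H⁰(ℙ¹, 𝒪(k)) → H⁰(S_f, 𝒪(k))` is surjective for `k ≥ n - 1`. -/
theorem exists_ofForm_eq {n k : ℕ} (hf : f.IsHomogeneous n) (hk : n ≤ k + 1)
    {s : RingY f × RingX f} (hs : s ∈ H0 f k) :
    ∃ P : MvPolynomial (Fin 2) K, P.IsHomogeneous k ∧ ofForm f P = s := by
  obtain ⟨c, p', q', ⟨hp, hq, h1, h2⟩, hc⟩ := exists_isConnecting f (k := k) hs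
  have hF := toLaurent_mem_degreePart hf
  have hc' : (p' : Laurent K) - q' =
      toLaurent K f * restrictTo {m : ℤ × ℤ | m.1 + m.2 = (k : ℤ) - n} c := by
    rw [← restrictTo_degree_mul hF, ← hc, add_sub_cancel]
    exact (restrictTo_degree_eq_self (Submodule.sub_mem _ hp hq)).symm
  -- Here k - n ≥ -1, so the cocycle splits as u - v; correcting the two lifts by f u and f v makes
  -- them agree, hence come from a form.
  obtain ⟨u, v, hu, hv, huv⟩ := exists_sub_eq_of_mem_degreePart (by omega)
    (restrictTo_degree_mem_degreePart ((k : ℤ) - n) c)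
  have key : (p' : Laurent K) - toLaurent K f * u = q' - toLaurent K f * v := by
    rw [← huv] at hc'
    linear_combination hc'
  have hd : (p' : Laurent K) - toLaurent K f * u ∈ degreePart K k := by
    refine Submodule.sub_mem _ hp ?_
    have := mul_mem_degreePart hF hu
    rwa [add_sub_cancel] at this
  obtain ⟨P, hP, hPc⟩ := exists_toLaurent_eq hd (p' - toChartY K f * u).2
    (by rw [key]; exact (q' - toChartX K f * v).2)
  refine ⟨P, hP, Prod.ext ?_ ?_⟩
  · have : toChartY K P = p' - toChartY K f * u := Subtype.ext hPc
    change mkY f (toChartY K P) = _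
    rw [this, map_sub, mkY_mul_self, sub_zero, h1]
  · have : toChartX K P = q' - toChartX K f * v := Subtype.ext (hPc.trans key)
    change mkX f (toChartX K P) = _
    rw [this, map_sub, mkX_mul_self, sub_zero, h2]

/-! ### The residue functional on `H⁰(S_f, 𝒪_{S_f}(k))` -/

/-- Changing the lifts alters the cocycle by b - d with b regular on D⁺(y) and d regular on D⁺(x).
Neither contains x⁻¹y⁻¹, in any degree. -/
theorem coeff_eq_of_isConnecting (hf : f ≠ 0) {k : ℤ} {s : RingY f × RingX f} {c c' : Laurent K}
    (hc : IsConnecting f k s c) (hc' : IsConnecting f k s c') :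
    c.coeff (-1, -1) = c'.coeff (-1, -1) := by
  have hF : toLaurent K f ≠ 0 := (map_ne_zero_iff _ toLaurent_injective).mpr hf
  obtain ⟨p, q, ⟨-, -, hp, hq⟩, hpq⟩ := hc
  obtain ⟨p', q', ⟨-, -, hp', hq'⟩, hpq'⟩ := hc'
  obtain ⟨b, hb⟩ := Ideal.mem_span_singleton.mp (Ideal.Quotient.eq.mp (hp'.trans hp.symm))
  obtain ⟨d, hd⟩ := Ideal.mem_span_singleton.mp (Ideal.Quotient.eq.mp (hq'.trans hq.symm))
  have hb' : (p' : Laurent K) - p = toLaurent K f * b := congrArg Subtype.val hb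
  have hd' : (q' : Laurent K) - q = toLaurent K f * d := congrArg Subtype.val hd
  have hcc : c' = c + b - d := by
    apply mul_left_cancel₀ hF
    rw [mul_sub, mul_add, ← hpq, ← hpq', ← hb', ← hd']
    ring
  have h1 : (b : Laurent K).coeff (-1, -1) = 0 := by
    by_contra h
    have h2 := b.2 _ h
    simp at h2
  have h2 : (d : Laurent K).coeff (-1, -1) = 0 := by
    by_contra h
    have h2 := d.2 _ h
    simp at h2
  simp [hcc, h1, h2]

/-- The coefficient of `(xy)⁻¹` in a cocycle representing the image of a section of `𝒪_{S_f}(k)`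
under the connecting map. -/
def residue (f : MvPolynomial (Fin 2) K) (k : ℤ) (s : twist f k) : K :=
  (exists_isConnecting f s.2).choose.coeff (-1, -1)

theorem residue_eq (hf : f ≠ 0) {k : ℤ} (s : twist f k) {c : Laurent K}
    (hc : IsConnecting f k s c) : residue f k s = c.coeff (-1, -1) :=
  coeff_eq_of_isConnecting hf (exists_isConnecting f s.2).choose_spec hc

theorem IsConnecting.add {k : ℤ} {s t : RingY f × RingX f} {c d : Laurent K}
    (hs : IsConnecting f k s c) (ht : IsConnecting f k t d) :
    IsConnecting f k (s + t) (c + d) := by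
  obtain ⟨p, q, ⟨h1, h2, h3, h4⟩, h⟩ := hs
  obtain ⟨p', q', ⟨h1', h2', h3', h4'⟩, h'⟩ := ht
  refine ⟨p + p', q + q', ⟨Submodule.add_mem _ h1 h1', Submodule.add_mem _ h2 h2', ?_, ?_⟩, ?_⟩
  · simp [h3, h3']
  · simp [h4, h4']
  · rw [mul_add, ← h, ← h']
    push_cast
    ring

theorem IsConnecting.smul {k : ℤ} {s : RingY f × RingX f} {c : Laurent K} (r : K)
    (hs : IsConnecting f k s c) : IsConnecting f k (r • s) (r • c) := by
  obtain ⟨p, q, ⟨h1, h2, h3, h4⟩, h⟩ := hs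
  refine ⟨r • p, r • q, ⟨Submodule.smul_mem _ r h1, Submodule.smul_mem _ r h2, ?_, ?_⟩, ?_⟩
  · simp [h3]
  · simp [h4]
  · rw [mul_smul_comm, ← h, smul_sub]
    rfl

theorem IsConnecting.ofForm_mul {k : ℤ} {j : ℕ} {a : MvPolynomial (Fin 2) K}
    (ha : a.IsHomogeneous j) {s : RingY f × RingX f} {c : Laurent K} (hs : IsConnecting f k s c) :
    IsConnecting f (j + k) (ofForm f a * s) (toLaurent K a * c) := by
  obtain ⟨p, q, ⟨h1, h2, h3, h4⟩, h⟩ := hs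
  refine ⟨toChartY K a * p, toChartX K a * q,
    ⟨mul_mem_degreePart (toLaurent_mem_degreePart ha) h1,
      mul_mem_degreePart (toLaurent_mem_degreePart ha) h2, ?_, ?_⟩, ?_⟩
  · rw [map_mul, h3]; rfl
  · rw [map_mul, h4]; rfl
  · rw [mul_left_comm, ← h, mul_sub]
    rfl

theorem isConnecting_ofForm {k : ℕ} {P : MvPolynomial (Fin 2) K} (hP : P.IsHomogeneous k) :
    IsConnecting f k (ofForm f P) 0 :=
  ⟨_, _, isLift_ofForm hP, by rw [mul_zero]; exact sub_self _⟩

theorem residue_add (hf : f ≠ 0) {k : ℤ} (s t : twist f k) :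
    residue f k (s + t) = residue f k s + residue f k t := by
  rw [residue_eq hf (s + t) ((exists_isConnecting f s.2).choose_spec.add
    (exists_isConnecting f t.2).choose_spec)]
  rfl

theorem residue_smul (hf : f ≠ 0) {k : ℤ} (r : K) (s t : twist f k)
    (hst : (t : RingY f × RingX f) = r • (s : RingY f × RingX f)) :
    residue f k t = r * residue f k s := by
  have h := (exists_isConnecting f s.2).choose_spec.smul r
  rw [← hst] at h
  rw [residue_eq hf t h]
  rfl

theorem residue_ofForm (hf : f ≠ 0) {k : ℕ} {P : MvPolynomial (Fin 2) K} (hP : P.IsHomogeneous k)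
    (s : twist f k) (hs : (s : RingY f × RingX f) = ofForm f P) : residue f k s = 0 := by
  have h := isConnecting_ofForm (f := f) hP
  rw [← hs] at h
  rw [residue_eq hf s h]
  rfl

theorem single_mem_degreePart (m : ℤ × ℤ) {k : ℤ} (h : m.1 + m.2 = k) :
    AddMonoidAlgebra.single m (1 : K) ∈ degreePart K k := by
  rw [degreePart, AddMonoidAlgebra.supported_eq_span_single]
  exact Submodule.subset_span ⟨m, h, rfl⟩

/-- Surjectivity of the connecting map `H⁰(S_f, 𝒪(n - 2)) → H¹(ℙ¹, 𝒪(-2))`. -/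
theorem exists_residue_eq_one (hf0 : f ≠ 0) {n : ℕ} (hf : f.IsHomogeneous n) {k : ℤ}
    (hk : k = (n : ℤ) - 2) (hk' : -1 ≤ k) :
    ∃ s : twist f k, residue f k s = 1 := by
  -- The section is built backwards from the cocycle (xy)⁻¹: its product with f has degree n - 2 ≥
  -- -1, so it is a difference p - q of sections on the two charts.
  have hc : toLaurent K f * AddMonoidAlgebra.single ((-1, -1) : ℤ × ℤ) 1 ∈ degreePart K k := by
    have := mul_mem_degreePart (toLaurent_mem_degreePart hf)
      (single_mem_degreePart (K := K) (-1, -1) (k := -2) (by simp))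
    rwa [← sub_eq_add_neg, ← hk] at this
  obtain ⟨p, q, hp, hq, hpq⟩ := exists_sub_eq_of_mem_degreePart hk' hc
  have hs : (mkY f p, mkX f q) ∈ H0 f k :=
    ⟨⟨p, q, hp, hq, rfl, rfl⟩, Ideal.Quotient.eq.mpr (by
      change (p : Laurent K) - q ∈ _
      rw [hpq]
      exact Ideal.mul_mem_right _ _ (Ideal.mem_span_singleton_self _))⟩
  refine ⟨⟨_, hs⟩, ?_⟩
  rw [residue_eq hf0 _ ⟨p, q, ⟨hp, hq, rfl, rfl⟩, hpq⟩]
  simp [AddMonoidAlgebra.coeff_single]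

/-- The connecting map commutes with multiplication by `a`, so every ev_a is multiplication by `a`
followed by one functional, the residue on H⁰(S_f, 𝒪(n-2)). -/
theorem ev_eq_residue (hf : f ≠ 0) {n : ℕ} {a : MvPolynomial (Fin 2) K} (ha : a.IsHomogeneous 1)
    (s : I f n) {k : ℤ} (hk : k = (n : ℤ) - 2) (t : twist f k) (hst : ofForm f a * s = t) :
    ev f a s = residue f k t := by
  obtain ⟨c, hc⟩ := exists_isConnecting f s.2
  have h := hc.ofForm_mul ha
  rw [hst, show ((1 : ℕ) : ℤ) + ((n : ℤ) - 3) = k by omega] at h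
  rw [residue_eq hf t h, ev_eq f hf a s hc]

theorem ev_add {n : ℕ} (a b : MvPolynomial (Fin 2) K) (s : I f n) :
    ev f (a + b) s = ev f a s + ev f b s := by
  simp [ev, add_mul]

theorem ev_C_mul {n : ℕ} (r : K) (a : MvPolynomial (Fin 2) K) (s : I f n) :
    ev f (MvPolynomial.C r * a) s = r * ev f a s := by
  simp [ev, ← MvPolynomial.smul_eq_C_mul]

/-! ### Linear forms that do not vanish on `S_f` -/

theorem aeval_mul_right {S : Type*} [CommRing S] [Algebra K S] {n : ℕ} (hf : f.IsHomogeneous n)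
    (v : Fin 2 → S) (u : S) :
    MvPolynomial.aeval (fun i => v i * u) f = MvPolynomial.aeval v f * u ^ n := by
  conv_lhs => rw [f.as_sum]
  conv_rhs => rw [f.as_sum]
  simp only [map_sum, Finset.sum_mul]
  refine Finset.sum_congr rfl fun m hm => ?_
  have hm' := hf (MvPolynomial.mem_support_iff.mp hm)
  rw [Finsupp.weight_apply, Finsupp.sum_fintype _ _ (by simp)] at hm'
  rw [MvPolynomial.aeval_monomial, MvPolynomial.aeval_monomial,
    Finsupp.prod_fintype _ _ (by simp), Finsupp.prod_fintype _ _ (by simp), ← hm']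
  simp [mul_pow, Finset.prod_mul_distrib, Finset.prod_pow_eq_pow_sum, mul_assoc]

/-- Modulo `a` each variable equals a multiple `v i` of `X j`, so homogeneity gives f ≡ f(v) X_j^n.
-/
theorem dvd_sub_C_eval_mul_pow {n : ℕ} (hf : f.IsHomogeneous n) (a : MvPolynomial (Fin 2) K)
    (v : Fin 2 → K) (j : Fin 2)
    (h : ∀ i, a ∣ MvPolynomial.X i - MvPolynomial.C (v i) * MvPolynomial.X j) :
    a ∣ f - MvPolynomial.C (MvPolynomial.eval v f) * MvPolynomial.X j ^ n := by
  have h1 : MvPolynomial.aeval (fun i => MvPolynomial.C (v i) * MvPolynomial.X j) f =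
      MvPolynomial.C (MvPolynomial.eval v f) * MvPolynomial.X (R := K) j ^ n := by
    rw [aeval_mul_right hf (fun i => MvPolynomial.C (v i))]
    congr 1
    exact (MvPolynomial.aeval_algebraMap_apply (MvPolynomial (Fin 2) K) v f).trans
      (by simp [MvPolynomial.algebraMap_eq, MvPolynomial.aeval_eq_eval])
  rw [← h1, ← Ideal.mem_span_singleton, ← Ideal.Quotient.eq]
  have h2 : (Ideal.Quotient.mkₐ K (Ideal.span {a})).comp
      (MvPolynomial.aeval (fun i => MvPolynomial.C (v i) * MvPolynomial.X j)) =
      Ideal.Quotient.mkₐ K (Ideal.span {a}) := by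
    refine MvPolynomial.algHom_ext fun i => ?_
    rw [AlgHom.comp_apply, MvPolynomial.aeval_X]
    exact (Ideal.Quotient.eq.mpr (Ideal.mem_span_singleton.mpr (h i))).symm
  exact (DFunLike.congr_fun h2 f).symm

/-- With w = X_j^(-n), the inverse of a modulo f is -c⁻¹ h w, since a h = f - c X_j^n. Only the
component of h of degree n - 1 is kept, to make u homogeneous; the submonoid `T` lets one statement
serve both charts. -/
theorem exists_mul_sub_one_eq {n : ℕ} (hf : f.IsHomogeneous n) {a h : MvPolynomial (Fin 2) K}
    (ha : a.IsHomogeneous 1) {c : K} (hc : c ≠ 0) {j : Fin 2}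
    (hh : f - MvPolynomial.C c * MvPolynomial.X j ^ n = a * h) {w : Laurent K}
    (hw : w ∈ degreePart K (-n)) (hwj : toLaurent K (MvPolynomial.X j ^ n) * w = 1) :
    ∃ u ∈ degreePart K (-1),
      (∀ T : AddSubmonoid (ℤ × ℤ), w ∈ supportedIn K T → (1, 0) ∈ T → (0, 1) ∈ T →
        u ∈ supportedIn K T) ∧
      toLaurent K a * u - 1 = toLaurent K f * (-(c⁻¹ • w)) := by
  set H : Laurent K := restrictTo {m : ℤ × ℤ | m.1 + m.2 = (n : ℤ) - 1} (toLaurent K h) with hH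
  have h1 : toLaurent K a * H = toLaurent K f - c • toLaurent K (MvPolynomial.X j ^ n) := by
    rw [hH, ← restrictTo_degree_mul (toLaurent_mem_degreePart ha), ← map_mul, ← hh]
    rw [show ((1 : ℕ) : ℤ) + ((n : ℤ) - 1) = n by push_cast; ring]
    rw [restrictTo_degree_eq_self, map_sub, ← MvPolynomial.smul_eq_C_mul, map_smul]
    refine toLaurent_mem_degreePart (hf.sub ?_)
    exact MvPolynomial.isHomogeneous_C_mul_X_pow c j n
  refine ⟨-(c⁻¹ • (H * w)), ?_, ?_, ?_⟩
  · refine Submodule.neg_mem _ (Submodule.smul_mem _ _ ?_)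
    have := mul_mem_degreePart (restrictTo_degree_mem_degreePart ((n : ℤ) - 1)
      (toLaurent K h)) hw
    rwa [show (n : ℤ) - 1 + -n = -1 by ring] at this
  · intro T hwT h10 h01
    exact (supportedIn K T).neg_mem ((supportedIn K T).smul_mem ((supportedIn K T).mul_mem
      (restrictTo_mem_supportedIn (toLaurent_mem_supportedIn h10 h01 h) _) hwT) _)
  · rw [mul_neg, mul_smul_comm, ← mul_assoc, h1, sub_mul, smul_mul_assoc, hwj, smul_sub,
      smul_smul, inv_mul_cancel₀ hc, one_smul, mul_neg, mul_smul_comm]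
    ring

theorem mkY_mul_mkY_eq_one {a : MvPolynomial (Fin 2) K} {u w : Laurent K} {hu : u ∈ chartY K}
    (hw : w ∈ chartY K) (h : toLaurent K a * u - 1 = toLaurent K f * w) :
    mkY f (toChartY K a) * mkY f ⟨u, hu⟩ = 1 := by
  have h' : toChartY K a * ⟨u, hu⟩ - 1 = toChartY K f * ⟨w, hw⟩ := Subtype.ext h
  rw [← map_mul, ← sub_eq_zero, ← map_one (mkY f), ← map_sub, h', mkY_mul_self]

theorem mkX_mul_mkX_eq_one {a : MvPolynomial (Fin 2) K} {u w : Laurent K} {hu : u ∈ chartX K}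
    (hw : w ∈ chartX K) (h : toLaurent K a * u - 1 = toLaurent K f * w) :
    mkX f (toChartX K a) * mkX f ⟨u, hu⟩ = 1 := by
  have h' : toChartX K a * ⟨u, hu⟩ - 1 = toChartX K f * ⟨w, hw⟩ := Subtype.ext h
  rw [← map_mul, ← sub_eq_zero, ← map_one (mkX f), ← map_sub, h', mkX_mul_self]

/-- A linear form that does not vanish on `S_f` trivializes `𝒪_{S_f}(1)`. -/
theorem exists_ofForm_mul_eq_one {n : ℕ} (hf : f.IsHomogeneous n) {t : K} (ht : t ≠ 0)
    (hft : MvPolynomial.eval ![-t, 1] f ≠ 0) :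
    ∃ u ∈ H0 f (-1), ofForm f (MvPolynomial.X 0 + MvPolynomial.C t * MvPolynomial.X 1) * u = 1 := by
  set a : MvPolynomial (Fin 2) K := MvPolynomial.X 0 + MvPolynomial.C t * MvPolynomial.X 1 with ha
  have hah : a.IsHomogeneous 1 :=
    (MvPolynomial.isHomogeneous_X K 0).add (MvPolynomial.isHomogeneous_C_mul_X t 1)
  -- The zero of x + ty is normalized as (-t, 1) for the chart D⁺(y) and as (1, -1/t) for D⁺(x); the
  -- latter needs t ≠ 0.
  have hft' : MvPolynomial.eval ![1, -t⁻¹] f ≠ 0 := by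
    have h := aeval_mul_right hf ![1, -t⁻¹] (-t)
    have hv : (fun i => ![1, -t⁻¹] i * -t) = ![-t, 1] := by
      ext i
      fin_cases i <;> simp [ht]
    rw [hv, MvPolynomial.aeval_eq_eval, MvPolynomial.aeval_eq_eval] at h
    rw [h] at hft
    exact left_ne_zero_of_mul hft
  obtain ⟨h, hh⟩ := dvd_sub_C_eval_mul_pow hf a ![-t, 1] 1 fun i => by
    fin_cases i
    · exact ⟨1, by simp [ha]⟩
    · exact ⟨0, by simp⟩
  obtain ⟨h', hh'⟩ := dvd_sub_C_eval_mul_pow hf a ![1, -t⁻¹] 0 fun i => by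
    fin_cases i
    · exact ⟨0, by simp⟩
    · refine ⟨MvPolynomial.C t⁻¹, ?_⟩
      have : (MvPolynomial.C t * MvPolynomial.C t⁻¹ : MvPolynomial (Fin 2) K) = 1 := by
        rw [← map_mul, mul_inv_cancel₀ ht, map_one]
      simp [ha]
      linear_combination -MvPolynomial.X 1 * this
  obtain ⟨u, hu, huT, hua⟩ := exists_mul_sub_one_eq hf hah hft hh
    (w := AddMonoidAlgebra.single (0, -(n : ℤ)) 1)
    (single_mem_degreePart _ (by simp))
    (by simp [toLaurent, AddMonoidAlgebra.single_pow, AddMonoidAlgebra.single_mul_single,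
      AddMonoidAlgebra.one_def]; rfl)
  obtain ⟨v, hv, hvT, hva⟩ := exists_mul_sub_one_eq hf hah hft' hh'
    (w := AddMonoidAlgebra.single (-(n : ℤ), 0) 1)
    (single_mem_degreePart _ (by simp))
    (by simp [toLaurent, AddMonoidAlgebra.single_pow, AddMonoidAlgebra.single_mul_single,
      AddMonoidAlgebra.one_def]; rfl)
  have hwY : AddMonoidAlgebra.single (0, -(n : ℤ)) (1 : K) ∈ chartY K :=
    single_mem_supportedIn (by simp) 1
  have hwX : AddMonoidAlgebra.single (-(n : ℤ), 0) (1 : K) ∈ chartX K :=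
    single_mem_supportedIn (by simp) 1
  have huY : u ∈ chartY K := huT _ hwY (by simp) (by simp)
  have hvX : v ∈ chartX K := hvT _ hwX (by simp) (by simp)
  have h1 : mkY f (toChartY K a) * mkY f ⟨u, huY⟩ = 1 :=
    mkY_mul_mkY_eq_one ((chartY K).neg_mem ((chartY K).smul_mem hwY _)) hua
  have h2 : mkX f (toChartX K a) * mkX f ⟨v, hvX⟩ = 1 :=
    mkX_mul_mkX_eq_one ((chartX K).neg_mem ((chartX K).smul_mem hwX _)) hva
  refine ⟨(mkY f ⟨u, huY⟩, mkX f ⟨v, hvX⟩), ⟨⟨_, _, hu, hv, rfl, rfl⟩, ?_⟩, Prod.ext h1 h2⟩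
  -- On the overlap both local sections are inverse to the same element, so they agree.
  have e1 := congrArg (resY f) h1
  have e2 := congrArg (resX f) h2
  rw [map_mul, map_one] at e1 e2
  have e : resY f (mkY f (toChartY K a)) = resX f (mkX f (toChartX K a)) := rfl
  rw [e] at e1
  exact (inv_unique (y := resY f (mkY f ⟨u, huY⟩)) (z := resX f (mkX f ⟨v, hvX⟩)) e1 e2)

/-! ### The structure of `L_f` and `I_f` in terms of a coordinate on `S_f` -/

instance : SMul (L f) (RingY f × RingX f) := Algebra.toSMul

instance (k : ℤ) : AddCommGroup (twist f k) := (twist f k).addCommGroup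

instance (k : ℤ) : Module (L f) (twist f k) := (twist f k).module

instance (k : ℤ) : SMul (L f) (twist f k) := Submodule.smul _

/-- The linear form `x + t y`. -/
def linearForm (t : K) : MvPolynomial (Fin 2) K :=
  MvPolynomial.X 0 + MvPolynomial.C t * MvPolynomial.X 1

theorem isHomogeneous_linearForm (t : K) : (linearForm t).IsHomogeneous 1 :=
  (MvPolynomial.isHomogeneous_X K 0).add (MvPolynomial.isHomogeneous_C_mul_X t 1)

/-- The dehomogenization with respect to `x + t y`, in terms of the coordinate `y / (x + t y)`. -/
def dehomogenize (t : K) : MvPolynomial (Fin 2) K →ₐ[K] Polynomial K :=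
  MvPolynomial.aeval ![1 - Polynomial.C t * Polynomial.X, Polynomial.X]

/-- A trivialization of the sheaves `𝒪_{S_f}(k)` by powers of the linear form `x + t y`, together
with the coordinate `θ = y / (x + t y)`. The section `w` of `𝒪_{S_f}(n - 3)` is
`(x + t y) ^ (n - 3)`. -/
structure Trivialization (f : MvPolynomial (Fin 2) K) (n : ℕ) where
  t : K
  θ : L f
  w : I f n
  ρ : L f →ₗ[K] K
  eval_ne_zero : MvPolynomial.eval ![-t, 1] f ≠ 0
  range_aeval : (Polynomial.aeval (R := K) θ).range = ⊤
  aeval_dehomogenize : Polynomial.aeval θ (dehomogenize t f) = 0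
  exists_smul_eq : ∀ s : I f n, ∃ l : L f, l • w = s
  eq_zero_of_smul : ∀ l : L f, l • w = 0 → l = 0
  ρ_apply : ∀ l, ρ l = ev f (linearForm t) (l • w)
  ev_X_one : ∀ s : I f n, ev f (MvPolynomial.X 1) s = ev f (linearForm t) (θ • s)
  ρ_pow : ∀ i, i + 2 ≤ n → ρ (θ ^ i) = 0
  exists_ρ_ne_zero : ∃ l, ρ l ≠ 0

theorem mem_L {s : RingY f × RingX f} : s ∈ L f ↔ s ∈ H0 f 0 := Iff.rfl

theorem mem_twist {k : ℤ} {s : RingY f × RingX f} : s ∈ twist f k ↔ s ∈ H0 f k := Iff.rfl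

theorem exists_eval_ne_zero [Infinite K] {n : ℕ} (hf : f.IsHomogeneous n) (hf0 : f ≠ 0) :
    ∃ t : K, t ≠ 0 ∧ MvPolynomial.eval ![-t, 1] f ≠ 0 := by
  -- The extra factors x and y force both coordinates of the chosen point to be nonzero, so that t =
  -- -v₀/v₁ is defined and nonzero.
  have h : f * MvPolynomial.X 0 * MvPolynomial.X 1 ≠ 0 :=
    mul_ne_zero (mul_ne_zero hf0 (MvPolynomial.X_ne_zero 0)) (MvPolynomial.X_ne_zero 1)
  obtain ⟨v, hv⟩ : ∃ v, MvPolynomial.eval v (f * MvPolynomial.X 0 * MvPolynomial.X 1) ≠ 0 := by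
    by_contra! h'
    exact h (MvPolynomial.funext fun v => by rw [h' v, map_zero])
  simp only [map_mul, MvPolynomial.eval_X, mul_ne_zero_iff] at hv
  obtain ⟨⟨h1, h2⟩, h3⟩ := hv
  refine ⟨-(v 0 / v 1), neg_ne_zero.mpr (div_ne_zero h2 h3), fun h => h1 ?_⟩
  have e := aeval_mul_right hf ![-(-(v 0 / v 1)), 1] (v 1)
  have hv : (fun i => ![-(-(v 0 / v 1)), 1] i * v 1) = v := by
    ext i
    fin_cases i <;> simp [h3]
  rw [hv, MvPolynomial.aeval_eq_eval, MvPolynomial.aeval_eq_eval, h, zero_mul] at e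
  exact e

theorem mul_pow_mem_H0 {k l : ℤ} {s t : RingY f × RingX f} (hs : s ∈ H0 f k) (ht : t ∈ H0 f l)
    (m : ℕ) : s * t ^ m ∈ H0 f (k + m * l) := by
  induction m with
  | zero => simpa using hs
  | succ m ih =>
    have := mul_mem_H0 f ih ht
    rw [pow_succ, ← mul_assoc]
    rwa [add_assoc, ← add_one_mul, ← Nat.cast_succ] at this

/-- As `u` is inverse to x + ty, one has θ = yu and 1 - tθ = xu; homogeneity then pulls out u^k. -/
theorem aeval_dehomogenize_eq {t : K} {θ : L f} {u : RingY f × RingX f}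
    (hθ : (θ : RingY f × RingX f) = ofForm f (MvPolynomial.X 1) * u)
    (hu : ofForm f (linearForm t) * u = 1) {k : ℕ} {P : MvPolynomial (Fin 2) K}
    (hP : P.IsHomogeneous k) :
    (Polynomial.aeval θ (dehomogenize t P) : RingY f × RingX f) = ofForm f P * u ^ k := by
  have h1 : ofForm f (MvPolynomial.X 0) * u = 1 - algebraMap K _ t * θ := by
    rw [hθ, ← hu, linearForm, map_add, map_mul, ← MvPolynomial.algebraMap_eq, AlgHom.commutes]
    ring
  have h2 : (L f).val.comp ((Polynomial.aeval θ).comp (dehomogenize t)) =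
      MvPolynomial.aeval (fun i => ofForm f (MvPolynomial.X i) * u) := by
    refine MvPolynomial.algHom_ext fun i => ?_
    fin_cases i
    · simp [dehomogenize, h1]
    · simp [dehomogenize, hθ]
  have h3 := DFunLike.congr_fun h2 P
  rw [aeval_mul_right hP (fun i => ofForm f (MvPolynomial.X i))] at h3
  rw [show MvPolynomial.aeval (fun i => ofForm f (MvPolynomial.X i)) = ofForm f from
    MvPolynomial.algHom_ext fun i => by simp] at h3
  exact h3

theorem exists_trivialization [Infinite K] {n : ℕ} (hn : 2 ≤ n) (hf : f.IsHomogeneous n)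
    (hf0 : f ≠ 0) : Nonempty (Trivialization f n) := by
  obtain ⟨m, rfl⟩ := Nat.exists_eq_add_of_le' hn
  obtain ⟨t, ht, hft⟩ := exists_eval_ne_zero hf hf0
  obtain ⟨u, hu, hau⟩ := exists_ofForm_mul_eq_one hf ht hft
  change ofForm f (linearForm t) * u = 1 at hau
  set a := ofForm f (linearForm t) with ha
  have haH : a ∈ H0 f 1 := by
    have := ofForm_mem_H0 (f := f) (isHomogeneous_linearForm t)
    rwa [Nat.cast_one] at this
  have hXH : ofForm f (MvPolynomial.X 1) ∈ H0 f 1 := by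
    have := ofForm_mem_H0 (f := f) (MvPolynomial.isHomogeneous_X K 1)
    rwa [Nat.cast_one] at this
  have hau' (k : ℕ) : a ^ k * u ^ k = 1 := by rw [← mul_pow, hau, one_pow]
  have hθ : ofForm f (MvPolynomial.X 1) * u ∈ L f := by
    have := mul_mem_H0 f hXH hu
    rwa [add_neg_cancel, ← mem_L] at this
  let θ : L f := ⟨_, hθ⟩
  -- This is (x + ty)^(n-3), written with one inverse factor because n - 3 = -1 when n = 2.
  have hw : u * a ^ m ∈ I f (m + 2) := by
    have := mul_pow_mem_H0 hu haH m
    rwa [show (-1 : ℤ) + m * 1 = ((m + 2 : ℕ) : ℤ) - 3 by push_cast; ring, ← mem_twist] at this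
  let w : I f (m + 2) := ⟨_, hw⟩
  have hv (l : L f) : (l : RingY f × RingX f) * a ^ m ∈ twist f m := by
    have := mul_pow_mem_H0 (mem_L.mp l.2) haH m
    rwa [show (0 : ℤ) + m * 1 = m by ring, ← mem_twist] at this
  have hk : (m : ℤ) = ((m + 2 : ℕ) : ℤ) - 2 := by push_cast; ring
  let ρ : L f →ₗ[K] K :=
    { toFun l := residue f m ⟨_, hv l⟩
      map_add' l l' := by
        rw [← residue_add hf0]
        congr 1
        exact Subtype.ext (add_mul _ _ _)
      map_smul' r l := by
        refine residue_smul hf0 r _ _ ?_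
        exact smul_mul_assoc _ _ _ }
  have hdeg {k : ℕ} {P : MvPolynomial (Fin 2) K} (hP : P.IsHomogeneous k) :=
    aeval_dehomogenize_eq (f := f) (θ := θ) rfl hau hP
  refine ⟨⟨t, θ, w, ρ, hft, ?_, ?_, ?_, ?_, ?_, ?_, ?_, ?_⟩⟩
  -- θ generates L_f: l a^(n-1) lifts to a form P of degree n - 1, and l = P u^(n-1) is a polynomial
  -- in θ.
  · rw [eq_top_iff]
    intro l _
    have h : (l : RingY f × RingX f) * a ^ (m + 1) ∈ H0 f ((m + 1 : ℕ) : ℤ) := by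
      have := mul_pow_mem_H0 (mem_L.mp l.2) haH (m + 1)
      rwa [show (0 : ℤ) + (m + 1 : ℕ) * 1 = (m + 1 : ℕ) by ring] at this
    obtain ⟨P, hP, hPl⟩ := exists_ofForm_eq hf (by omega) h
    refine ⟨dehomogenize t P, Subtype.ext ((hdeg hP).trans ?_)⟩
    rw [hPl, mul_assoc, hau', mul_one]
  · refine Subtype.ext ((hdeg hf).trans ?_)
    rw [ofForm_self, zero_mul]
    rfl
  · intro s
    have h : (s : RingY f × RingX f) * a * u ^ m ∈ L f := by
      have := mul_pow_mem_H0 (mul_mem_H0 f (mem_twist.mp s.2) haH) hu m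
      rwa [show ((m + 2 : ℕ) : ℤ) - 3 + 1 + m * -1 = 0 by push_cast; ring, ← mem_L] at this
    refine ⟨⟨_, h⟩, Subtype.ext ?_⟩
    change (s : RingY f × RingX f) * a * u ^ m * (u * a ^ m) = s
    linear_combination (s : RingY f × RingX f) * (a * u) * hau' m + (s : RingY f × RingX f) * hau
  · intro l hl
    have h : (l : RingY f × RingX f) * (u * a ^ m) = 0 := congrArg Subtype.val hl
    refine Subtype.ext ?_
    change (l : RingY f × RingX f) = 0
    linear_combination a * u ^ m * h - (l : RingY f × RingX f) * (a * u) * hau' m -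
      (l : RingY f × RingX f) * hau
  · intro l
    refine (ev_eq_residue hf0 (isHomogeneous_linearForm t) _ hk _ ?_).symm
    change a * ((l : RingY f × RingX f) * (u * a ^ m)) = l * a ^ m
    linear_combination (l : RingY f × RingX f) * a ^ m * hau
  · intro s
    have h : ofForm f (MvPolynomial.X 1) * s ∈ twist f m := by
      have := mul_mem_H0 f hXH (mem_twist.mp s.2)
      rwa [show (1 : ℤ) + (((m + 2 : ℕ) : ℤ) - 3) = m by push_cast; ring, ← mem_twist] at this
    rw [ev_eq_residue hf0 (MvPolynomial.isHomogeneous_X K 1) s hk ⟨_, h⟩ rfl]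
    refine (ev_eq_residue hf0 (isHomogeneous_linearForm t) _ hk _ ?_).symm
    change a * ((ofForm f (MvPolynomial.X 1) * u) * (s : RingY f × RingX f)) =
      ofForm f (MvPolynomial.X 1) * s
    linear_combination ofForm f (MvPolynomial.X 1) * (s : RingY f × RingX f) * hau
  -- θ^i a^(n-2) = a^(n-2-i) y^i is the restriction of a form, so its residue vanishes.
  · intro i hi
    refine residue_ofForm hf0 (P := linearForm t ^ (m - i) * MvPolynomial.X 1 ^ i) ?_ _ ?_
    · have := ((isHomogeneous_linearForm t).pow (m - i)).mul
        ((MvPolynomial.isHomogeneous_X K 1).pow i)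
      rwa [one_mul, one_mul, Nat.sub_add_cancel (by omega)] at this
    · change (ofForm f (MvPolynomial.X 1) * u) ^ i * a ^ m = _
      rw [map_mul, map_pow, map_pow, ← ha]
      obtain ⟨j, rfl⟩ := Nat.exists_eq_add_of_le' (show i ≤ m by omega)
      rw [Nat.add_sub_cancel]
      linear_combination a ^ j * ofForm f (MvPolynomial.X 1) ^ i * hau' i
  -- Divide a section of 𝒪(n-2) of residue 1 by a^(n-2).
  · obtain ⟨s, hs⟩ := exists_residue_eq_one hf0 hf hk (by omega)
    have h : (s : RingY f × RingX f) * u ^ m ∈ L f := by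
      have := mul_pow_mem_H0 (mem_twist.mp s.2) hu m
      rwa [show (m : ℤ) + m * -1 = 0 by ring, ← mem_L] at this
    refine ⟨⟨_, h⟩, ?_⟩
    have e : (⟨_, hv ⟨_, h⟩⟩ : twist f m) = s := Subtype.ext (by
      change (s : RingY f × RingX f) * u ^ m * a ^ m = s
      linear_combination (s : RingY f × RingX f) * hau' m)
    change residue f m ⟨_, hv ⟨_, h⟩⟩ ≠ 0
    rw [e, hs]
    exact one_ne_zero

/-! ### Degree and leading coefficient of the dehomogenization. -/

theorem dehomogenize_monomial (t : K) (m : Fin 2 →₀ ℕ) (r : K) :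
    dehomogenize t (MvPolynomial.monomial m r) =
      Polynomial.C r * ((1 - Polynomial.C t * Polynomial.X) ^ m 0 * Polynomial.X ^ m 1) := by
  rw [dehomogenize, MvPolynomial.aeval_monomial, Finsupp.prod_fintype _ _ (by simp)]
  simp [Fin.prod_univ_two]

theorem natDegree_one_sub_C_mul_X_le (t : K) :
    (1 - Polynomial.C t * Polynomial.X).natDegree ≤ 1 := by
  compute_degree

/-- In f(1 - tz, z) each monomial x^i y^j with i + j = n contributes (-t)^i to the coefficient of
z^n. So the degree is exactly n once x + ty does not vanish on S_f. -/
theorem dehomogenize_natDegree_le_and_coeff {n : ℕ} (hf : f.IsHomogeneous n) (t : K) :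
    (dehomogenize t f).natDegree ≤ n ∧
      (dehomogenize t f).coeff n = MvPolynomial.eval ![-t, 1] f := by
  conv => rw [f.as_sum]
  simp only [map_sum, Polynomial.finsetSum_coeff, dehomogenize_monomial]
  have key : ∀ m ∈ f.support, m 0 * 1 + m 1 = n := fun m hm => by
    have hm' := hf (MvPolynomial.mem_support_iff.mp hm)
    rw [Finsupp.weight_apply, Finsupp.sum_fintype _ _ (by simp)] at hm'
    simpa [Fin.sum_univ_two] using hm'
  have hd (m : Fin 2 →₀ ℕ) :
      ((1 - Polynomial.C t * Polynomial.X) ^ m 0 : Polynomial K).natDegree ≤ m 0 * 1 :=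
    Polynomial.natDegree_pow_le_of_le _ (natDegree_one_sub_C_mul_X_le t)
  constructor
  · refine Polynomial.natDegree_sum_le_of_forall_le _ _ fun m hm => ?_
    refine (Polynomial.natDegree_C_mul_le _ _).trans ?_
    rw [← key m hm]
    exact Polynomial.natDegree_mul_le_of_le (hd m) (Polynomial.natDegree_X_pow_le _)
  · refine Finset.sum_congr rfl fun m hm => ?_
    rw [← key m hm, Polynomial.coeff_C_mul,
      Polynomial.coeff_mul_add_eq_of_natDegree_le (hd m) (Polynomial.natDegree_X_pow_le _),
      Polynomial.coeff_pow_of_natDegree_le (natDegree_one_sub_C_mul_X_le t),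
      MvPolynomial.eval_monomial, Finsupp.prod_fintype _ _ (by simp)]
    simp [Fin.prod_univ_two, Polynomial.coeff_one]

/-! ### L_f as K[z]/(g), and the nondegenerate pairing ρ(l l'). -/

namespace Trivialization

variable {n : ℕ} (T : Trivialization f n)

/-- The minimal polynomial of the coordinate, up to a scalar. -/
def g : Polynomial K := dehomogenize T.t f

theorem natDegree_g (hf : f.IsHomogeneous n) : T.g.natDegree = n :=
  Polynomial.natDegree_eq_of_le_of_coeff_ne_zero (dehomogenize_natDegree_le_and_coeff hf T.t).1
    ((dehomogenize_natDegree_le_and_coeff hf T.t).2 ▸ T.eval_ne_zero)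

theorem leadingCoeff_g (hf : f.IsHomogeneous n) :
    T.g.leadingCoeff = MvPolynomial.eval ![-T.t, 1] f := by
  rw [Polynomial.leadingCoeff, T.natDegree_g hf]
  exact (dehomogenize_natDegree_le_and_coeff hf T.t).2

theorem g_ne_zero (hf : f.IsHomogeneous n) : T.g ≠ 0 := by
  rw [← Polynomial.leadingCoeff_ne_zero, T.leadingCoeff_g hf]
  exact T.eval_ne_zero

theorem exists_aeval_eq (l : L f) : ∃ p : Polynomial K, Polynomial.aeval T.θ p = l :=
  T.range_aeval.ge (Algebra.mem_top (x := l))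

theorem ρ_aeval {p : Polynomial K} (hp : p.natDegree + 1 ≤ n) :
    T.ρ (Polynomial.aeval T.θ p) = p.coeff (n - 1) * T.ρ (T.θ ^ (n - 1)) := by
  obtain ⟨m, rfl⟩ := Nat.exists_eq_add_of_le' (show 1 ≤ n by omega)
  rw [Polynomial.aeval_eq_sum_range' (n := m + 1) (by omega), map_sum, Finset.sum_range_succ,
    Finset.sum_eq_zero, zero_add, map_smul, Nat.add_sub_cancel, smul_eq_mul]
  intro i hi
  rw [map_smul, T.ρ_pow i (by have := Finset.mem_range.mp hi; omega), smul_zero]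

variable {T}

theorem exists_aeval_eq_of_natDegree_lt (hf : f.IsHomogeneous n) (hn : n ≠ 0) (l : L f) :
    ∃ p : Polynomial K, p.natDegree < n ∧ Polynomial.aeval T.θ p = l := by
  obtain ⟨p, rfl⟩ := T.exists_aeval_eq l
  refine ⟨p % T.g, ?_, ?_⟩
  · have := Polynomial.natDegree_mod_lt p (q := T.g) (by rw [T.natDegree_g hf]; exact hn)
    rwa [T.natDegree_g hf] at this
  · conv_rhs => rw [← EuclideanDomain.div_add_mod p T.g]
    rw [map_add, map_mul, g, T.aeval_dehomogenize, zero_mul, zero_add]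

theorem ρ_pow_ne_zero (hf : f.IsHomogeneous n) (hn : n ≠ 0) : T.ρ (T.θ ^ (n - 1)) ≠ 0 := by
  obtain ⟨l, hl⟩ := T.exists_ρ_ne_zero
  obtain ⟨p, hp, rfl⟩ := exists_aeval_eq_of_natDegree_lt (T := T) hf hn l
  rw [T.ρ_aeval hp] at hl
  exact right_ne_zero_of_mul hl

/-- The power of θ raises p to degree exactly n - 1, where ρ reads off the leading coefficient up to
a nonzero scalar. This gives both nondegeneracy of the pairing and the absence of relations of
degree below n. -/
theorem ρ_pow_mul_aeval_ne_zero (hf : f.IsHomogeneous n) (hn : n ≠ 0) {p : Polynomial K}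
    (hp : p ≠ 0) (hp' : p.natDegree < n) :
    T.ρ (T.θ ^ (n - 1 - p.natDegree) * Polynomial.aeval T.θ p) ≠ 0 := by
  have h : T.θ ^ (n - 1 - p.natDegree) * Polynomial.aeval T.θ p =
      Polynomial.aeval T.θ (p * Polynomial.X ^ (n - 1 - p.natDegree)) := by
    rw [map_mul, map_pow, Polynomial.aeval_X, mul_comm]
  rw [h, T.ρ_aeval, mul_ne_zero_iff]
  · refine ⟨?_, ρ_pow_ne_zero hf hn⟩
    rw [Polynomial.coeff_mul_X_pow', if_pos (by omega),
      show n - 1 - (n - 1 - p.natDegree) = p.natDegree by omega]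
    exact Polynomial.leadingCoeff_ne_zero.mpr hp
  · rw [Polynomial.natDegree_mul_X_pow]
    · omega
    · exact hp

/-- The pairing `(l, l') ↦ ρ (l l')` is nondegenerate. -/
theorem eq_zero_of_ρ_mul (hf : f.IsHomogeneous n) (hn : n ≠ 0) {l : L f}
    (h : ∀ l', T.ρ (l' * l) = 0) : l = 0 := by
  obtain ⟨p, hp, rfl⟩ := exists_aeval_eq_of_natDegree_lt (T := T) hf hn l
  by_contra h0
  exact ρ_pow_mul_aeval_ne_zero hf hn (fun h' => h0 (by rw [h', map_zero])) hp (h _)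

theorem aeval_eq_zero_iff (hf : f.IsHomogeneous n) (hn : n ≠ 0) {p : Polynomial K} :
    Polynomial.aeval T.θ p = 0 ↔ T.g ∣ p := by
  constructor
  · intro h
    rw [← EuclideanDomain.mod_eq_zero]
    have h1 : Polynomial.aeval T.θ (p % T.g) = 0 := by
      rw [← EuclideanDomain.div_add_mod p T.g, map_add, map_mul] at h
      rwa [g, T.aeval_dehomogenize, zero_mul, zero_add] at h
    by_contra h0
    have h2 := Polynomial.natDegree_mod_lt p (q := T.g) (by rw [T.natDegree_g hf]; exact hn)
    rw [T.natDegree_g hf] at h2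
    exact ρ_pow_mul_aeval_ne_zero (T := T) hf hn h0 h2 (by rw [h1, mul_zero, map_zero])
  · rintro ⟨q, rfl⟩
    rw [map_mul, g, T.aeval_dehomogenize, zero_mul]

variable (T) in
/-- The algebra map from `K[z] / (g)` to `L_f` sending `z` to `θ`. -/
def ofAdjoinRoot : AdjoinRoot T.g →ₐ[K] L f :=
  AdjoinRoot.liftAlgHom T.g (Algebra.ofId K (L f)) T.θ T.aeval_dehomogenize

theorem ofAdjoinRoot_mk (p : Polynomial K) :
    T.ofAdjoinRoot (AdjoinRoot.mk T.g p) = Polynomial.aeval T.θ p :=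
  AdjoinRoot.liftAlgHom_mk T.g (Algebra.ofId K (L f)) T.θ T.aeval_dehomogenize p

variable (T) in
/-- `L_f` is generated by the coordinate `θ`, with the single relation `g θ = 0`. -/
def adjoinRootEquiv (hf : f.IsHomogeneous n) (hn : n ≠ 0) : AdjoinRoot T.g ≃ₐ[K] L f :=
  AlgEquiv.ofBijective T.ofAdjoinRoot (by
      constructor
      · rw [injective_iff_map_eq_zero]
        intro x hx
        induction x using AdjoinRoot.induction_on with
        | ih p =>
          rw [ofAdjoinRoot_mk] at hx
          exact AdjoinRoot.mk_eq_zero.mpr ((aeval_eq_zero_iff hf hn).mp hx)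
      · intro l
        obtain ⟨p, rfl⟩ := T.exists_aeval_eq l
        exact ⟨AdjoinRoot.mk T.g p, ofAdjoinRoot_mk p⟩)

theorem adjoinRootEquiv_mk (hf : f.IsHomogeneous n) (hn : n ≠ 0) (p : Polynomial K) :
    T.adjoinRootEquiv hf hn (AdjoinRoot.mk T.g p) = Polynomial.aeval T.θ p :=
  ofAdjoinRoot_mk p

variable (T)

include T in
theorem finrank_L (hf : f.IsHomogeneous n) (hn : n ≠ 0) : Module.finrank K (L f) = n := by
  rw [← (T.adjoinRootEquiv hf hn).toLinearEquiv.finrank_eq,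
    (AdjoinRoot.powerBasis (T.g_ne_zero hf)).finrank, AdjoinRoot.powerBasis_dim, T.natDegree_g hf]

include T in
theorem finite_L (hf : f.IsHomogeneous n) (hn : n ≠ 0) : Module.Finite K (L f) :=
  Module.finite_of_finrank_pos (by rw [T.finrank_L hf hn]; omega)

/-- The Frobenius property: a nondegenerate pairing on a finite-dimensional space represents every
functional. -/
theorem exists_ρ_mul_eq (hf : f.IsHomogeneous n) (hn : n ≠ 0) (ψ : L f →ₗ[K] K) :
    ∃ l₀, ∀ l, T.ρ (l * l₀) = ψ l := by
  have := T.finite_L hf hn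
  let B : L f →ₗ[K] Module.Dual K (L f) := (LinearMap.mul K (L f)).flip.compr₂ T.ρ
  have hB : Function.Injective B := by
    rw [injective_iff_map_eq_zero]
    intro l hl
    exact eq_zero_of_ρ_mul hf hn fun l' => LinearMap.congr_fun hl l'
  obtain ⟨l₀, h⟩ := (LinearMap.injective_iff_surjective_of_finrank_eq_finrank
    (Subspace.dual_finrank_eq (K := K) (V := L f)).symm).mp hB ψ
  exact ⟨l₀, fun l => LinearMap.congr_fun h l⟩

theorem ev_smul_smul_w (l l' : L f) : ev f (linearForm T.t) (l • l' • T.w) = T.ρ (l * l') := by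
  rw [smul_smul, T.ρ_apply]

/-- `ev` rests on a chosen cocycle; writing sections as multiples of `w` transfers additivity from
the linear map ρ. -/
theorem ev_smul_add (l l' : L f) (s s' : I f n) :
    ev f (linearForm T.t) (l • s + l' • s') =
      ev f (linearForm T.t) (l • s) + ev f (linearForm T.t) (l' • s') := by
  obtain ⟨k, rfl⟩ := T.exists_smul_eq s
  obtain ⟨k', rfl⟩ := T.exists_smul_eq s'
  rw [smul_smul, smul_smul, ← add_smul, ← T.ρ_apply, ← T.ρ_apply, ← T.ρ_apply, map_add]

theorem ev_add_right (s s' : I f n) :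
    ev f (linearForm T.t) (s + s') = ev f (linearForm T.t) s + ev f (linearForm T.t) s' := by
  simpa using T.ev_smul_add 1 1 s s'

theorem ev_algebraMap_smul (r : K) (s : I f n) :
    ev f (linearForm T.t) (algebraMap K (L f) r • s) = r * ev f (linearForm T.t) s := by
  obtain ⟨k, rfl⟩ := T.exists_smul_eq s
  rw [smul_smul, ← T.ρ_apply, ← T.ρ_apply, ← Algebra.smul_def, map_smul, smul_eq_mul]

/-- Upgrades scalar identities for ev_a to identities in I_f. -/
theorem eq_zero_of_ev_smul (hf : f.IsHomogeneous n) (hn : n ≠ 0) {s : I f n}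
    (h : ∀ l : L f, ev f (linearForm T.t) (l • s) = 0) : s = 0 := by
  obtain ⟨k, rfl⟩ := T.exists_smul_eq s
  rw [eq_zero_of_ρ_mul (T := T) hf hn fun l => (T.ev_smul_smul_w l k).symm.trans (h l), zero_smul]

theorem ev_X_zero (s : I f n) :
    ev f (MvPolynomial.X 0) s =
      ev f (linearForm T.t) s - T.t * ev f (linearForm T.t) (T.θ • s) := by
  rw [← T.ev_X_one, eq_sub_iff_add_eq, ← ev_C_mul, ← ev_add]
  rfl

end Trivialization

/-! ### Top exterior powers -/

section Exterior

variable {n : ℕ} {M : Type*} [AddCommGroup M] [Module K M]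

/-- The coordinate of an element of the top exterior power with respect to a basis. -/
def topCoord (b : Module.Basis (Fin n) K M) : ⋀[K]^n M →ₗ[K] K :=
  exteriorPower.alternatingMapLinearEquiv b.det

theorem topCoord_ιMulti (b : Module.Basis (Fin n) K M) (v : Fin n → M) :
    topCoord b (exteriorPower.ιMulti K n v) = b.det v :=
  exteriorPower.alternatingMapLinearEquiv_apply_ιMulti _ _

theorem topCoord_injective (b : Module.Basis (Fin n) K M) : Function.Injective (topCoord b) := by
  have := Module.Finite.of_basis b
  have h1 : Module.finrank K (⋀[K]^n M) = Module.finrank K K := by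
    rw [exteriorPower.finrank_eq, Module.finrank_eq_card_basis b, Fintype.card_fin,
      Nat.choose_self, Module.finrank_self]
  rw [LinearMap.injective_iff_surjective_of_finrank_eq_finrank h1]
  intro c
  exact ⟨c • exteriorPower.ιMulti K n b, by
    rw [map_smul, topCoord_ιMulti, Module.Basis.det_self, smul_eq_mul, mul_one]⟩

theorem ιMulti_eq_iff_det_eq_one (b b' : Module.Basis (Fin n) K M) :
    exteriorPower.ιMulti K n b' = exteriorPower.ιMulti K n b ↔ (b.toMatrix b').det = 1 := by
  rw [← (topCoord_injective b).eq_iff, topCoord_ιMulti, topCoord_ιMulti, Module.Basis.det_self,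
    Module.Basis.det_apply]

theorem ιMulti_basis_ne_zero (b : Module.Basis (Fin n) K M) : exteriorPower.ιMulti K n b ≠ 0 := by
  intro h
  have := topCoord_ιMulti b b
  rw [h, map_zero, Module.Basis.det_self] at this
  exact zero_ne_one this

theorem exists_basis_ιMulti_eq (hn : n ≠ 0) (b : Module.Basis (Fin n) K M) {e : ⋀[K]^n M}
    (he : e ≠ 0) : ∃ b' : Module.Basis (Fin n) K M, exteriorPower.ιMulti K n b' = e := by
  have hc : topCoord b e ≠ 0 := (map_ne_zero_iff _ (topCoord_injective b)).mpr he
  -- Rescaling a single basis vector by the coordinate of e corrects the volume.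
  let w : Fin n → Kˣ := Function.update 1 ⟨0, Nat.pos_of_ne_zero hn⟩ (Units.mk0 _ hc)
  refine ⟨b.unitsSMul w, topCoord_injective b ?_⟩
  have h : (⇑(b.unitsSMul w) : Fin n → M) = fun i => (w i : K) • b i := by
    ext i
    rw [Module.Basis.unitsSMul_apply, Units.smul_def]
  rw [topCoord_ιMulti, h, AlternatingMap.map_smul_univ, Module.Basis.det_self, smul_eq_mul, mul_one,
    Finset.prod_eq_single ⟨0, Nat.pos_of_ne_zero hn⟩]
  · simp [w]
  · intro i _ hi
    simp [w, hi]
  · simp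

end Exterior

theorem φ_smul_left {n : ℕ} {M : Type u} [AddCommGroup M] [Module (L f) M]
    (φ : M ⊗[L f] M ≃ₗ[L f] I f n) (l : L f) (u v : M) :
    φ ((l • u) ⊗ₜ[L f] v) = l • φ (u ⊗ₜ[L f] v) := by
  rw [← TensorProduct.smul_tmul', map_smul]

theorem φ_smul_right {n : ℕ} {M : Type u} [AddCommGroup M] [Module (L f) M]
    (φ : M ⊗[L f] M ≃ₗ[L f] I f n) (l : L f) (u v : M) :
    φ (u ⊗ₜ[L f] (l • v)) = l • φ (u ⊗ₜ[L f] v) := by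
  rw [TensorProduct.tmul_smul, map_smul]

namespace Trivialization

variable {n : ℕ} (T : Trivialization f n)

/-! ### The bilinear form `ev_a ∘ φ` for `a = x + t y` -/

section Form

variable {M : Type u} [AddCommGroup M] [Module K M] [Module (L f) M] [IsScalarTower K (L f) M]
  (φ : M ⊗[L f] M ≃ₗ[L f] I f n)

/-- The bilinear form `ev_a ∘ φ` for `a = x + t y`. -/
def form : LinearMap.BilinForm K M :=
  LinearMap.mk₂ K (fun u v => ev f (linearForm T.t) (φ (u ⊗ₜ[L f] v)))
    (fun u u' v => by rw [TensorProduct.add_tmul, map_add, T.ev_add_right])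
    (fun r u v => by
      rw [← algebraMap_smul (L f) r u, φ_smul_left, T.ev_algebraMap_smul, smul_eq_mul])
    (fun u v v' => by rw [TensorProduct.tmul_add, map_add, T.ev_add_right])
    (fun r u v => by
      rw [← algebraMap_smul (L f) r v, φ_smul_right, T.ev_algebraMap_smul, smul_eq_mul])

theorem form_apply (u v : M) : T.form φ u v = ev f (linearForm T.t) (φ (u ⊗ₜ[L f] v)) := rfl

theorem form_smul_left (l : L f) (u v : M) :
    T.form φ (l • u) v = ev f (linearForm T.t) (l • φ (u ⊗ₜ[L f] v)) := by
  rw [form_apply, φ_smul_left]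

variable (M) in
/-- Multiplication by the coordinate `θ`. -/
def mulθ : M →ₗ[K] M := (LinearMap.lsmul (L f) M T.θ).restrictScalars K

theorem ev_X_one_φ (u v : M) :
    ev f (MvPolynomial.X 1) (φ (u ⊗ₜ[L f] v)) = T.form φ (T.mulθ M u) v := by
  rw [T.ev_X_one]
  exact (T.form_smul_left φ T.θ u v).symm

theorem ev_X_zero_φ (u v : M) :
    ev f (MvPolynomial.X 0) (φ (u ⊗ₜ[L f] v)) =
      T.form φ u v - T.t * T.form φ (T.mulθ M u) v := by
  rw [T.ev_X_zero, form_apply]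
  congr 2
  exact (T.form_smul_left φ T.θ u v).symm

theorem gram_X_one (b : Module.Basis (Fin n) K M) :
    gram f φ b (MvPolynomial.X 1) =
      LinearMap.BilinForm.toMatrix b ((T.form φ).compLeft (T.mulθ M)) := by
  ext i j
  rw [LinearMap.BilinForm.toMatrix_apply]
  exact T.ev_X_one_φ φ _ _

theorem gram_X_zero (b : Module.Basis (Fin n) K M) :
    gram f φ b (MvPolynomial.X 0) = LinearMap.BilinForm.toMatrix b
      (T.form φ - T.t • (T.form φ).compLeft (T.mulθ M)) := by
  ext i j
  rw [LinearMap.BilinForm.toMatrix_apply]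
  exact T.ev_X_zero_φ φ _ _

end Form

include T in
theorem gram_basis_change {M : Type u} [AddCommGroup M] [Module K M] [Module (L f) M]
    [IsScalarTower K (L f) M] (φ : M ⊗[L f] M ≃ₗ[L f] I f n) (b b' : Module.Basis (Fin n) K M)
    (i : Fin 2) :
    gram f φ b' (MvPolynomial.X i) =
      (b.toMatrix b').transpose * gram f φ b (MvPolynomial.X i) * b.toMatrix b' := by
  fin_cases i
  · simp only [Fin.zero_eta, T.gram_X_zero]
    exact (LinearMap.BilinForm.toMatrix_mul_basis_toMatrix b b' _).symm
  · simp only [Fin.mk_one, T.gram_X_one]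
    exact (LinearMap.BilinForm.toMatrix_mul_basis_toMatrix b b' _).symm

end Trivialization

/-! ### `f`-modules -/

namespace FModule

variable {n : ℕ} (P : FModule f n)

theorem exists_linearEquiv [Nontrivial (L f)] : Nonempty (L f ≃ₗ[L f] P.M) := by
  have := P.free
  have : Module.Finite (L f) P.M :=
    Module.finite_of_finrank_pos (by rw [P.rank_eq_one]; exact one_pos)
  exact ⟨LinearEquiv.ofFinrankEq _ _ (by rw [P.rank_eq_one, Module.finrank_self])⟩

/-- In rank one, u and v are multiples of one generator, and the scalars commute. -/
theorem φ_symm [Nontrivial (L f)] (u v : P.M) : P.φ (u ⊗ₜ[L f] v) = P.φ (v ⊗ₜ[L f] u) := by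
  obtain ⟨η⟩ := P.exists_linearEquiv
  obtain ⟨l, rfl⟩ := η.surjective u
  obtain ⟨l', rfl⟩ := η.surjective v
  have h (k : L f) : η k = k • η 1 := by rw [← map_smul, smul_eq_mul, mul_one]
  rw [h l, h l', φ_smul_left, φ_smul_left,
    φ_smul_right, φ_smul_right, smul_comm]

theorem gram_isSymm [Nontrivial (L f)] (b : Module.Basis (Fin n) K P.M)
    (a : MvPolynomial (Fin 2) K) : (gram f P.φ b a).IsSymm := by
  ext i j
  exact congrArg (ev f a) (P.φ_symm _ _)

variable {P} (T : Trivialization f n)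

include T in
theorem exists_basis (hf : f.IsHomogeneous n) (hn : n ≠ 0) [Nontrivial (L f)] :
    ∃ b : Module.Basis (Fin n) K P.M, exteriorPower.ιMulti K n b = P.e := by
  obtain ⟨η⟩ := P.exists_linearEquiv
  have := T.finite_L hf hn
  let b := Module.finBasisOfFinrankEq K (L f) (T.finrank_L hf hn)
  exact exists_basis_ιMulti_eq hn (b.map (η.restrictScalars K)) P.e_ne_zero

/-- Letting v run over the multiples of a generator m, nondegeneracy gives φ(u ⊗ m) = 0, hence u ⊗ m
= 0; contracting with M ⊗ M ≅ L_f recovers u. -/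
theorem form_eq_zero (hf : f.IsHomogeneous n) (hn : n ≠ 0) [Nontrivial (L f)] {u : P.M}
    (h : ∀ v, T.form P.φ u v = 0) : u = 0 := by
  obtain ⟨η⟩ := P.exists_linearEquiv
  have h1 : P.φ (u ⊗ₜ[L f] η 1) = 0 := T.eq_zero_of_ev_smul hf hn fun l => by
    rw [← φ_smul_right]
    exact h _
  have h2 := P.φ.map_eq_zero_iff.mp h1
  have h3 := congrArg (TensorProduct.lift ((LinearMap.mul (L f) (L f)).compl₁₂
    η.symm.toLinearMap η.symm.toLinearMap)) h2
  rw [map_zero, TensorProduct.lift.tmul] at h3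
  simpa using h3

include T in
-- The linear map σ matching the bases preserves F = ev_a ∘ φ and F(θu, v). Nondegeneracy of F makes
-- σ commute with θ, hence with L_f; compatibility with φ follows by testing against ev_a(l ·) for
-- all l.
theorem isIso_of_gram_eq (hf : f.IsHomogeneous n) (hn : n ≠ 0) [Nontrivial (L f)]
    {P Q : FModule f n} {b : Module.Basis (Fin n) K P.M} {b' : Module.Basis (Fin n) K Q.M}
    (hb : exteriorPower.ιMulti K n b = P.e) (hb' : exteriorPower.ιMulti K n b' = Q.e)
    (hx : P.Ax b = Q.Ax b') (hy : P.Ay b = Q.Ay b') : P.IsIso Q := by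
  let σ : P.M ≃ₗ[K] Q.M := b.equiv b' (Equiv.refl _)
  have hσ (i : Fin n) : σ (b i) = b' i := by simp [σ]
  rw [FModule.Ax, FModule.Ax, T.gram_X_zero, T.gram_X_zero] at hx
  rw [FModule.Ay, FModule.Ay, T.gram_X_one, T.gram_X_one] at hy
  have ext_form {B : LinearMap.BilinForm K P.M} {C : LinearMap.BilinForm K Q.M}
      (h : LinearMap.BilinForm.toMatrix b B = LinearMap.BilinForm.toMatrix b' C) (u v : P.M) :
      C (σ u) (σ v) = B u v := by
    have h' : C.comp σ.toLinearMap σ.toLinearMap = B := b.ext fun i => b.ext fun j => by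
      have := congrFun (congrFun h i) j
      rw [LinearMap.BilinForm.toMatrix_apply, LinearMap.BilinForm.toMatrix_apply] at this
      simp [this, hσ]
    rw [← h']
    rfl
  have hY (u v : P.M) : T.form Q.φ (T.mulθ Q.M (σ u)) (σ v) = T.form P.φ (T.mulθ P.M u) v :=
    ext_form hy u v
  have hX (u v : P.M) :
      T.form Q.φ (σ u) (σ v) - T.t * T.form Q.φ (T.mulθ Q.M (σ u)) (σ v) =
        T.form P.φ u v - T.t * T.form P.φ (T.mulθ P.M u) v :=
    ext_form hx u v
  have hF (u v : P.M) : T.form Q.φ (σ u) (σ v) = T.form P.φ u v := by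
    linear_combination hX u v + T.t * hY u v
  have hθ (u : P.M) : σ (T.θ • u) = T.θ • σ u := by
    rw [← sub_eq_zero]
    refine form_eq_zero T hf hn fun v => ?_
    obtain ⟨v, rfl⟩ := σ.surjective v
    rw [map_sub, LinearMap.sub_apply, hF, sub_eq_zero]
    exact (hY u v).symm
  have hp (p : Polynomial K) :
      ∀ u, σ (Polynomial.aeval T.θ p • u) = Polynomial.aeval T.θ p • σ u := by
    induction p using Polynomial.induction_on with
    | C r => intro u; rw [Polynomial.aeval_C, algebraMap_smul, algebraMap_smul, map_smul]
    | add p q hp hq => intro u; rw [map_add, add_smul, map_add, hp, hq, add_smul]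
    | monomial m r h =>
      intro u
      rw [pow_succ, ← mul_assoc, map_mul, Polynomial.aeval_X, mul_smul, h, hθ, mul_smul]
  let ψ : P.M ≃ₗ[L f] Q.M :=
    { σ with
      map_smul' := fun l u => by
        obtain ⟨p, rfl⟩ := T.exists_aeval_eq l
        exact hp p u }
  refine ⟨ψ, fun u v => ?_, ?_⟩
  · rw [← sub_eq_zero]
    refine T.eq_zero_of_ev_smul hf hn fun l => ?_
    have h := T.ev_smul_add l (-l) (Q.φ (ψ u ⊗ₜ[L f] ψ v)) (P.φ (u ⊗ₜ[L f] v))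
    have h' := T.ev_smul_add l (-l) (P.φ (u ⊗ₜ[L f] v)) (P.φ (u ⊗ₜ[L f] v))
    have h0 : ev f (linearForm T.t) (0 : I f n) = 0 := by simpa using T.ev_add_right 0 0
    rw [neg_smul, add_neg_cancel, h0] at h'
    rw [smul_sub, sub_eq_add_neg, ← neg_smul, h, neg_smul, ← T.form_smul_left, ← map_smul ψ]
    rw [← T.form_smul_left] at h'
    rw [show T.form Q.φ (ψ (l • u)) (ψ v) = _ from hF _ _]
    exact h'.symm
  · rw [← hb, ← hb', exteriorPower.map_apply_ιMulti]
    congr 1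
    ext i
    exact hσ i

end FModule

/-! ### Cyclic vectors -/

/-- If p(N) = 0, then p vanishes at every eigenvalue. Over the algebraic closure the characteristic
polynomial has simple roots, so it divides p; divisibility descends to `K`. -/
theorem charpoly_dvd_of_aeval_eq_zero {n : ℕ} {N : Matrix (Fin n) (Fin n) K}
    (hN : N.charpoly.Separable) {p : Polynomial K} (hp : Polynomial.aeval N p = 0) :
    N.charpoly ∣ p := by
  rcases eq_or_ne p 0 with rfl | hp0
  · exact dvd_zero _
  rcases subsingleton_or_nontrivial (Matrix (Fin n) (Fin n) K) with hs | hs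
  · have : N.charpoly = 1 := by
      rw [Subsingleton.elim N 0]
      have : IsEmpty (Fin n) := by
        by_contra h
        rw [not_isEmpty_iff] at h
        exact not_nontrivial (Matrix (Fin n) (Fin n) K) inferInstance
      exact Matrix.det_isEmpty
    rw [this]
    exact one_dvd _
  let i := algebraMap K (AlgebraicClosure K)
  rw [← Polynomial.map_dvd_map' i]
  refine (IsAlgClosed.splits _).dvd_of_roots_le_roots
    (Polynomial.map_ne_zero (Matrix.charpoly_monic N).ne_zero) ?_
  rw [Multiset.le_iff_subset (Polynomial.nodup_roots hN.map)]
  intro r hr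
  have hmap : (N.map i).charpoly = N.charpoly.map i := Matrix.charpoly_map N i
  have hr' : r ∈ spectrum (AlgebraicClosure K) (N.map i) := by
    rw [Matrix.mem_spectrum_iff_isRoot_charpoly, hmap]
    exact Polynomial.isRoot_of_mem_roots hr
  have h1 := spectrum.subset_polynomial_aeval (N.map i) (p.map i) ⟨r, hr', rfl⟩
  have h2 : Polynomial.aeval (N.map i) (p.map i) = 0 := by
    have h3 := Polynomial.aeval_algHom_apply (Algebra.ofId K (AlgebraicClosure K)).mapMatrix N p
    rw [hp, map_zero] at h3
    rw [Polynomial.aeval_map_algebraMap]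
    exact h3
  have : Nontrivial (Matrix (Fin n) (Fin n) (AlgebraicClosure K)) := by
    have : Nonempty (Fin n) := by
      by_contra h
      rw [not_nonempty_iff] at h
      exact not_subsingleton (Matrix (Fin n) (Fin n) K) inferInstance
    infer_instance
  rw [h2, spectrum.zero_eq] at h1
  exact (Polynomial.mem_roots (Polynomial.map_ne_zero hp0)).mpr h1

/-- For each irreducible factor q of χ = `N.charpoly`, ker (χ/q)(N) is a proper subspace. Finitely
many of these cannot cover K^n, so take v outside them. If p(N)v = 0, then gcd(p, χ) kills v too;
were it a proper divisor of χ, it would divide some χ/q, a contradiction. -/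
theorem exists_cyclic_vector [Infinite K] {n : ℕ} {N : Matrix (Fin n) (Fin n) K}
    (hN : N.charpoly.Separable) :
    ∃ v : Fin n → K, ∀ p : Polynomial K,
      Polynomial.aeval (Matrix.toLin' N) p v = 0 → N.charpoly ∣ p := by
  classical
  have hc0 : N.charpoly ≠ 0 := (Matrix.charpoly_monic N).ne_zero
  have haeval (p : Polynomial K) :
      Polynomial.aeval (Matrix.toLin' N) p = Matrix.toLin' (Polynomial.aeval N p) :=
    Polynomial.aeval_algHom_apply (Matrix.toLinAlgEquiv' (R := K) (n := Fin n)) N p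
  let S : Finset (Subspace K (Fin n → K)) :=
    (UniqueFactorizationMonoid.normalizedFactors N.charpoly).toFinset.image fun q =>
      LinearMap.ker (Polynomial.aeval (Matrix.toLin' N) (N.charpoly / q))
  have hS : ⊤ ∉ S := by
    intro h
    obtain ⟨q, hq, hq'⟩ := Finset.mem_image.mp h
    rw [Multiset.mem_toFinset] at hq
    rw [LinearMap.ker_eq_top, haeval, LinearEquiv.map_eq_zero_iff] at hq'
    have h1 := charpoly_dvd_of_aeval_eq_zero hN hq'
    have hqi := UniqueFactorizationMonoid.irreducible_of_normalized_factor q hq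
    have h2 : q * (N.charpoly / q) = N.charpoly := EuclideanDomain.mul_div_cancel'
      hqi.ne_zero (UniqueFactorizationMonoid.dvd_of_mem_normalizedFactors hq)
    have h3 : N.charpoly / q ≠ 0 := fun h => hc0 (by rw [← h2, h, mul_zero])
    have h4 : q * (N.charpoly / q) ∣ 1 * (N.charpoly / q) := by rwa [h2, one_mul]
    exact hqi.not_isUnit (isUnit_of_dvd_one ((mul_dvd_mul_iff_right h3).mp h4))
  obtain ⟨v, hv⟩ := (Set.ne_univ_iff_exists_notMem _).mp (Subspace.biUnion_ne_univ_of_top_notMem hS)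
  refine ⟨v, fun p hp => ?_⟩
  have hann (a b : Polynomial K) (h : Polynomial.aeval (Matrix.toLin' N) a v = 0) :
      Polynomial.aeval (Matrix.toLin' N) (b * a) v = 0 := by
    rw [map_mul, Module.End.mul_apply, h, map_zero]
  have hchar : Polynomial.aeval (Matrix.toLin' N) N.charpoly v = 0 := by
    rw [haeval, Matrix.aeval_self_charpoly, map_zero, LinearMap.zero_apply]
  have hd : Polynomial.aeval (Matrix.toLin' N) (EuclideanDomain.gcd p N.charpoly) v = 0 := by
    rw [EuclideanDomain.gcd_eq_gcd_ab, map_add, LinearMap.add_apply, mul_comm p,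
      mul_comm N.charpoly, hann _ _ hp, hann _ _ hchar, add_zero]
  obtain ⟨e, he⟩ := EuclideanDomain.gcd_dvd_right p N.charpoly
  have he0 : e ≠ 0 := fun h => hc0 (by rw [he, h, mul_zero])
  by_cases hu : IsUnit e
  · have : N.charpoly ∣ EuclideanDomain.gcd p N.charpoly := by
      conv_lhs => rw [he]
      exact (hu.mul_right_dvd).mpr dvd_rfl
    exact this.trans (EuclideanDomain.gcd_dvd_left _ _)
  · exfalso
    obtain ⟨q, hq⟩ := UniqueFactorizationMonoid.exists_mem_normalizedFactors he0 hu
    obtain ⟨e', he'⟩ := UniqueFactorizationMonoid.dvd_of_mem_normalizedFactors hq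
    have hqi := UniqueFactorizationMonoid.irreducible_of_normalized_factor q hq
    have hq' : q ∈ UniqueFactorizationMonoid.normalizedFactors N.charpoly :=
      Multiset.mem_of_le ((UniqueFactorizationMonoid.dvd_iff_normalizedFactors_le_normalizedFactors
        he0 hc0).mp ⟨_, he.trans (mul_comm _ _)⟩) hq
    have hdiv : N.charpoly / q = e' * EuclideanDomain.gcd p N.charpoly := by
      refine (EuclideanDomain.eq_div_of_mul_eq_right hqi.ne_zero ?_).symm
      conv_rhs => rw [he, he']
      ring
    refine hv (Set.mem_biUnion (x := LinearMap.ker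
      (Polynomial.aeval (Matrix.toLin' N) (N.charpoly / q))) ?_ ?_)
    · exact Finset.mem_image_of_mem _ (Multiset.mem_toFinset.mpr hq')
    · rw [SetLike.mem_coe, LinearMap.mem_ker, hdiv]
      exact hann _ _ hd

/-! ### Forms of nonzero discriminant -/

theorem DiscrNeZero.ne_zero_of_ne {n : ℕ} {α β : Fin n → AlgebraicClosure K}
    (h : ∏ i, ∏ j ∈ Finset.Ioi i, (α i * β j - α j * β i) ^ 2 ≠ 0) {i j : Fin n} (hij : i ≠ j) :
    α i * β j - α j * β i ≠ 0 := by
  have key {i j : Fin n} (hij : i < j) : α i * β j - α j * β i ≠ 0 := by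
    have h1 := Finset.prod_ne_zero_iff.mp (Finset.prod_ne_zero_iff.mp h i (Finset.mem_univ _)) j
      (Finset.mem_Ioi.mpr hij)
    exact fun h2 => h1 (by rw [h2, zero_pow two_ne_zero])
  rcases lt_or_gt_of_ne hij with h | h
  · exact key h
  · rw [← neg_sub]
    exact neg_ne_zero.mpr (key h)

theorem DiscrNeZero.ne_zero {n : ℕ} (hn : 2 ≤ n) (hf : DiscrNeZero f n) : f ≠ 0 := by
  obtain ⟨α, β, h1, h2⟩ := hf
  rintro rfl
  rw [map_zero, eq_comm, Finset.prod_eq_zero_iff] at h1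
  obtain ⟨i, -, hi⟩ := h1
  have hα : α i = 0 := by
    have := congrArg (MvPolynomial.eval ![1, 0]) hi
    simpa using this
  have hβ : β i = 0 := by
    have := congrArg (MvPolynomial.eval ![0, 1]) hi
    simpa using this
  have : Nontrivial (Fin n) := Fin.nontrivial_iff_two_le.mpr hn
  obtain ⟨j, hj⟩ := exists_ne i
  exact ne_zero_of_ne h2 hj (by rw [hα, hβ, mul_zero, zero_mul, sub_zero])

theorem DiscrNeZero.separable_dehomogenize {n : ℕ} (hf : DiscrNeZero f n) {t : K}
    (hg : dehomogenize t f ≠ 0) : (dehomogenize t f).Separable := by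
  obtain ⟨α, β, h1, h2⟩ := hf
  let i := algebraMap K (AlgebraicClosure K)
  rw [← Polynomial.separable_map i]
  have hmap : (dehomogenize t f).map i =
      ∏ j, (Polynomial.C (α j) - Polynomial.C (i t * α j + β j) * Polynomial.X) := by
    have e : (Polynomial.mapRingHom i).comp (dehomogenize t).toRingHom =
        (dehomogenize (i t)).toRingHom.comp (MvPolynomial.map i) := by
      refine MvPolynomial.ringHom_ext (fun r => ?_) fun j => ?_
      · simp [dehomogenize]
      · fin_cases j <;> simp [dehomogenize]
    have e' := DFunLike.congr_fun e f
    simp only [RingHom.comp_apply] at e'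
    refine e'.trans ?_
    rw [h1]
    simp only [map_prod]
    refine Finset.prod_congr rfl fun j _ => ?_
    simp [dehomogenize]
    ring
  have h0 : (dehomogenize t f).map i ≠ 0 := Polynomial.map_ne_zero hg
  rw [hmap] at h0 ⊢
  refine Polynomial.separable_prod' (fun j _ k _ hjk => ?_) fun j _ => ?_
  · have hD := ne_zero_of_ne h2 hjk
    set D := α j * β k - α k * β j with hDdef
    have hD' : (Polynomial.C D⁻¹ * Polynomial.C D : Polynomial (AlgebraicClosure K)) = 1 := by
      rw [← map_mul, inv_mul_cancel₀ hD, map_one]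
    -- Eliminating z between the two linear factors leaves α_j β_k - α_k β_j = D.
    refine ⟨Polynomial.C D⁻¹ * Polynomial.C (i t * α k + β k),
      -(Polynomial.C D⁻¹ * Polynomial.C (i t * α j + β j)), ?_⟩
    rw [← hD', hDdef]
    simp only [map_sub, map_add, map_mul]
    ring
  · have hj := Finset.prod_ne_zero_iff.mp h0 j (Finset.mem_univ _)
    rw [Polynomial.separable_def]
    by_cases hb : i t * α j + β j = 0
    -- The factor is constant here, and nonzero because the whole product is.
    · rw [hb] at hj ⊢
      simp only [map_zero, zero_mul, sub_zero] at hj ⊢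
      obtain ⟨c, hc⟩ := (Polynomial.isUnit_C.mpr (isUnit_iff_ne_zero (a := α j).mpr
        fun h => hj (by rw [h, map_zero]))).exists_left_inv
      exact ⟨c, 0, by rw [hc, zero_mul, add_zero]⟩
    · obtain ⟨c, hc⟩ := (Polynomial.isUnit_C.mpr (isUnit_iff_ne_zero.mpr hb)).exists_left_inv
      refine ⟨0, -c, ?_⟩
      simp only [Polynomial.derivative_sub, Polynomial.derivative_C, Polynomial.derivative_C_mul,
        Polynomial.derivative_X, mul_one, zero_sub, zero_mul, zero_add, neg_mul_neg]
      exact hc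

/-! ### The `f`-module attached to a pair of symmetric matrices -/

theorem algHom_invariantForm {S : Type*} [CommRing S] [Algebra K S] {n : ℕ}
    (h : MvPolynomial (Fin 2) K →ₐ[K] S) (A B : Matrix (Fin n) (Fin n) K) :
    h (invariantForm A B) = (-1) ^ (n * (n - 1) / 2) *
      Matrix.det (h (MvPolynomial.X 0) • A.map (algebraMap K S) -
        h (MvPolynomial.X 1) • B.map (algebraMap K S)) := by
  rw [invariantForm, map_mul, map_pow, map_neg, map_one, AlgHom.map_det]
  congr 2
  ext i j
  simp only [AlgHom.mapMatrix_apply, Matrix.map_apply, Matrix.sub_apply, Matrix.smul_apply,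
    smul_eq_mul, map_sub, map_mul, ← MvPolynomial.algebraMap_eq, AlgHom.commutes]

namespace Trivialization

variable {n : ℕ} (T : Trivialization f n)

/-- At (x, y) = (-t, 1) the matrix xA - yB is -(B + tA), so this determinant is f(-t, 1) up to sign.
-/
theorem det_ne_zero {A B : Matrix (Fin n) (Fin n) K} (h : invariantForm A B = f) :
    (B + T.t • A).det ≠ 0 := by
  intro h0
  apply T.eval_ne_zero
  have h1 := algHom_invariantForm (MvPolynomial.aeval (R := K) (S₁ := K) ![-T.t, 1]) A B
  rw [h] at h1
  have h2 : MvPolynomial.aeval ![-T.t, 1] (MvPolynomial.X (R := K) 0) • A.map (algebraMap K K) -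
      MvPolynomial.aeval ![-T.t, 1] (MvPolynomial.X (R := K) 1) • B.map (algebraMap K K) =
      -(B + T.t • A) := by
    ext i j
    simp
    ring
  rw [h2, Matrix.det_neg, h0, mul_zero, mul_zero] at h1
  exact h1

/-- The matrix by which the coordinate `θ` acts on the `f`-module attached to `(A, B)`. -/
def actionMatrix (A B : Matrix (Fin n) (Fin n) K) : Matrix (Fin n) (Fin n) K :=
  (B + T.t • A)⁻¹ * A

theorem mul_actionMatrix {A B : Matrix (Fin n) (Fin n) K} (h : invariantForm A B = f) :
    (B + T.t • A) * T.actionMatrix A B = A :=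
  Matrix.mul_nonsing_inv_cancel_left _ _ (T.det_ne_zero h).isUnit

/-- With C = B + tA and N = C⁻¹A, substituting (1 - tz, z) gives (1 - tz)A - zB = A - zC = -C(z -
N); take determinants. -/
theorem associated_g_charpoly {A B : Matrix (Fin n) (Fin n) K} (h : invariantForm A B = f) :
    Associated T.g (T.actionMatrix A B).charpoly := by
  have h1 := algHom_invariantForm (dehomogenize T.t) A B
  rw [h] at h1
  have h2 : dehomogenize T.t (MvPolynomial.X 0) • A.map (algebraMap K (Polynomial K)) -
      dehomogenize T.t (MvPolynomial.X 1) • B.map (algebraMap K (Polynomial K)) =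
      -((B + T.t • A).map Polynomial.C * (T.actionMatrix A B).charmatrix) := by
    rw [Matrix.charmatrix, Matrix.mul_sub]
    have e : (B + T.t • A).map Polynomial.C * Polynomial.C.mapMatrix (T.actionMatrix A B) =
        A.map Polynomial.C := by
      rw [RingHom.mapMatrix_apply, ← Matrix.map_mul, T.mul_actionMatrix h]
    rw [e]
    refine Matrix.ext fun i j => ?_
    simp [dehomogenize, Matrix.mul_apply, Matrix.scalar_apply, Matrix.diagonal_apply]
    ring
  have hu (k : ℕ) : IsUnit ((-1 : Polynomial K) ^ k) := isUnit_one.neg.pow k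
  rw [h2, Matrix.det_neg, Matrix.det_mul, ← mul_assoc, ← mul_assoc] at h1
  have hdet : IsUnit ((B + T.t • A).map (Polynomial.C : K →+* Polynomial K)).det := by
    have := RingHom.map_det (Polynomial.C : K →+* Polynomial K) (B + T.t • A)
    rw [RingHom.mapMatrix_apply] at this
    rw [← this]
    exact Polynomial.isUnit_C.mpr (T.det_ne_zero h).isUnit
  change T.g = _ at h1
  rw [h1]
  exact (associated_isUnit_mul_left_iff (((hu _).mul (hu _)).mul hdet)).mpr (Associated.refl _)

/-- Balancedness makes C(η l, η l') a functional of l l', hence ρ(l l' l₀) for some l₀.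
Nondegeneracy of `C` makes l₀ a unit, so η l ⊗ η l' ↦ l l' l₀ w is an isomorphism onto I_f. -/
theorem exists_φ (hf : f.IsHomogeneous n) (hn : n ≠ 0) {M : Type u} [AddCommGroup M] [Module K M]
    [Module (L f) M] [IsScalarTower K (L f) M] (η : L f ≃ₗ[L f] M) (C : LinearMap.BilinForm K M)
    (hC : ∀ (l : L f) (u v : M), C (l • u) v = C u (l • v))
    (hC' : ∀ v, (∀ u, C u v = 0) → v = 0) :
    ∃ φ : M ⊗[L f] M ≃ₗ[L f] I f n, ∀ u v, T.form φ u v = C u v := by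
  have := T.finite_L hf hn
  obtain ⟨l₀, h₀⟩ := T.exists_ρ_mul_eq hf hn (C (η 1) ∘ₗ (η.restrictScalars K).toLinearMap)
  have hη (l : L f) : η l = l • η 1 := by rw [← map_smul, smul_eq_mul, mul_one]
  have hform (l l' : L f) : T.ρ (l * l' * l₀) = C (η l) (η l') := by
    rw [h₀, hη l, hC]
    change C (η 1) (η (l * l')) = _
    rw [← smul_eq_mul, map_smul]
  have h1 : ∀ l : L f, l * l₀ = 0 → l = 0 := fun l hl => by
    rw [← map_eq_zero_iff η η.injective]
    refine hC' _ fun u => ?_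
    obtain ⟨k, rfl⟩ := η.surjective u
    rw [← hform, mul_assoc, hl, mul_zero, map_zero]
  obtain ⟨l₁, hl₁⟩ : ∃ l₁, l₁ * l₀ = 1 :=
    LinearMap.surjective_of_injective (f := LinearMap.mulRight K l₀)
      ((injective_iff_map_eq_zero _).mpr h1) 1
  let κ : L f ≃ₗ[L f] I f n := LinearEquiv.ofBijective (LinearMap.toSpanSingleton (L f) _ (l₀ • T.w))
    ⟨(injective_iff_map_eq_zero _).mpr fun l hl => by
        rw [LinearMap.toSpanSingleton_apply, smul_smul] at hl
        exact h1 l (T.eq_zero_of_smul _ hl),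
      fun s => by
        obtain ⟨l, rfl⟩ := T.exists_smul_eq s
        exact ⟨l * l₁, by
          rw [LinearMap.toSpanSingleton_apply, smul_smul, mul_assoc, hl₁, mul_one]⟩⟩
  refine ⟨(TensorProduct.congr η.symm η.symm).trans ((TensorProduct.lid (L f) (L f)).trans κ),
    fun u v => ?_⟩
  obtain ⟨l, rfl⟩ := η.surjective u
  obtain ⟨l', rfl⟩ := η.surjective v
  rw [← hform, ← T.ev_smul_smul_w, form_apply]
  simp only [LinearEquiv.trans_apply, TensorProduct.congr_tmul, LinearEquiv.symm_apply_apply,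
    TensorProduct.lid_tmul]
  rfl

theorem exists_algHom (hf : f.IsHomogeneous n) (hn : n ≠ 0) {E : Type*} [Ring E] [Algebra K E]
    (N : E) (hN : Polynomial.aeval N T.g = 0) :
    ∃ σ : L f →ₐ[K] E, ∀ p : Polynomial K,
      σ (Polynomial.aeval T.θ p) = Polynomial.aeval N p := by
  let τ : AdjoinRoot T.g →ₐ[K] E := Ideal.Quotient.liftₐ (Ideal.span {T.g}) (Polynomial.aeval N)
    fun p hp => by
      obtain ⟨q, rfl⟩ := Ideal.mem_span_singleton.mp hp
      rw [map_mul, hN, zero_mul]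
  refine ⟨τ.comp (T.adjoinRootEquiv hf hn).symm.toAlgHom, fun p => ?_⟩
  have h : (T.adjoinRootEquiv hf hn).symm (Polynomial.aeval T.θ p) = AdjoinRoot.mk T.g p := by
    rw [AlgEquiv.symm_apply_eq, adjoinRootEquiv_mk]
  change τ ((T.adjoinRootEquiv hf hn).symm (Polynomial.aeval T.θ p)) = _
  rw [h]
  rfl

end Trivialization

namespace FModule

variable {n : ℕ} (T : Trivialization f n)

include T in
-- One basis suffices for the discriminant condition: bases of the same volume differ by a matrix of
-- determinant 1.
theorem exists_of_form {M : Type u} [AddCommGroup M] [Module K M]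
    [Module (L f) M] [IsScalarTower K (L f) M] [Nontrivial (L f)] (η : L f ≃ₗ[L f] M)
    {A B : Matrix (Fin n) (Fin n) K} (h : invariantForm A B = f) (b : Module.Basis (Fin n) K M)
    (φ : M ⊗[L f] M ≃ₗ[L f] I f n) (hA : gram f φ b (MvPolynomial.X 1) = A)
    (hB : gram f φ b (MvPolynomial.X 0) = B) :
    ∃ (P : FModule f n) (b : Module.Basis (Fin n) K P.M),
      exteriorPower.ιMulti K n b = P.e ∧ P.Ay b = A ∧ P.Ax b = B :=
  ⟨{ M := M
     free := Module.Free.of_equiv η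
     rank_eq_one := by rw [← η.finrank_eq, Module.finrank_self]
     φ := φ
     e := exteriorPower.ιMulti K n b
     e_ne_zero := ιMulti_basis_ne_zero b
     disc_eq := fun b' hb' => by
      rw [T.gram_basis_change φ b b', T.gram_basis_change φ b b', hA, hB,
        invariantForm_conj _ _ _ ((ιMulti_eq_iff_det_eq_one b b').mp hb'), h] }, b, rfl, hA, hB⟩

include T in
theorem exists_of_mem_Vf [Infinite K] (hf : f.IsHomogeneous n) (hn : n ≠ 0)
    (hd : DiscrNeZero f n) [Nontrivial (L f)] {A B : Matrix (Fin n) (Fin n) K} (hA : A.IsSymm)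
    (hB : B.IsSymm) (h : invariantForm A B = f) :
    ∃ (P : FModule f n) (b : Module.Basis (Fin n) K P.M),
      exteriorPower.ιMulti K n b = P.e ∧ P.Ay b = A ∧ P.Ax b = B := by
  set C := B + T.t • A with hC
  set N := T.actionMatrix A B with hNdef
  have hCN : C * N = A := T.mul_actionMatrix h
  have hCsymm : C.IsSymm := hB.add (hA.smul _)
  have hassoc := T.associated_g_charpoly h
  have hsep : N.charpoly.Separable :=
    (hd.separable_dehomogenize (T.g_ne_zero hf)).of_dvd hassoc.symm.dvd
  obtain ⟨v₀, hv₀⟩ := exists_cyclic_vector hsep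
  have hN0 : Polynomial.aeval (Matrix.toLin' N) T.g = 0 := by
    obtain ⟨q, hq⟩ := hassoc.symm.dvd
    have := LinearMap.aeval_self_charpoly (Matrix.toLin' N)
    rw [Matrix.charpoly_toLin'] at this
    rw [hq, map_mul, this, zero_mul]
  obtain ⟨σ, hσ⟩ := T.exists_algHom hf hn (Matrix.toLin' N) hN0
  let _ : Module (L f) (Fin n → K) := Module.compHom _ σ.toRingHom
  have hsmul (l : L f) (v : Fin n → K) : l • v = σ l v := rfl
  have : IsScalarTower K (L f) (Fin n → K) := ⟨fun r l v => by
    rw [hsmul, hsmul, map_smul, LinearMap.smul_apply]⟩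
  have hθ (v : Fin n → K) : T.θ • v = N.mulVec v := by
    have := hσ Polynomial.X
    rw [Polynomial.aeval_X, Polynomial.aeval_X] at this
    rw [hsmul, this, Matrix.toLin'_apply]
  let Cf : LinearMap.BilinForm K (Fin n → K) := Matrix.toBilin' C
  have hCf (u v : Fin n → K) : Cf u v = u ⬝ᵥ C.mulVec v := Matrix.toBilin'_apply' C u v
  -- With `hCfθ'`, this shows θ self-adjoint for C: both C and CN = A are symmetric.
  have hCfθ (u v : Fin n → K) : Cf (T.θ • u) v = u ⬝ᵥ A.mulVec v := by
    rw [hCf, hθ, Matrix.dotProduct_mulVec, ← Matrix.mulVec_transpose, hCsymm.eq,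
      Matrix.mulVec_mulVec, hCN, Matrix.dotProduct_mulVec, ← Matrix.mulVec_transpose, hA.eq]
  have := T.finite_L hf hn
  -- If p(θ) kills the cyclic vector, then g divides p and p(θ) = 0. So l ↦ l v₀ is injective, and
  -- both sides have dimension n.
  let η : L f ≃ₗ[L f] (Fin n → K) := LinearEquiv.ofBijective
      (LinearMap.toSpanSingleton (L f) _ v₀) (by
    have hinj : Function.Injective (LinearMap.toSpanSingleton (L f) (Fin n → K) v₀) := by
      rw [injective_iff_map_eq_zero]
      intro l hl
      obtain ⟨p, rfl⟩ := T.exists_aeval_eq l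
      rw [LinearMap.toSpanSingleton_apply, hsmul, hσ] at hl
      exact (Trivialization.aeval_eq_zero_iff hf hn).mpr (hassoc.dvd.trans (hv₀ p hl))
    refine ⟨hinj, ?_⟩
    exact (LinearMap.injective_iff_surjective_of_finrank_eq_finrank
      (f := (LinearMap.toSpanSingleton (L f) (Fin n → K) v₀).restrictScalars K)
      (by rw [T.finrank_L hf hn, Module.finrank_fin_fun])).mp hinj)
  have hCfθ' (u v : Fin n → K) : Cf u (T.θ • v) = u ⬝ᵥ A.mulVec v := by
    rw [hCf, hθ, Matrix.mulVec_mulVec, hCN]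
  have hadj (p : Polynomial K) : ∀ u v : Fin n → K,
      Cf (Polynomial.aeval T.θ p • u) v = Cf u (Polynomial.aeval T.θ p • v) := by
    induction p using Polynomial.induction_on with
    | C r =>
      intro u v
      rw [Polynomial.aeval_C, algebraMap_smul, algebraMap_smul, map_smul, map_smul,
        LinearMap.smul_apply]
    | add p q hp hq =>
      intro u v
      rw [map_add, add_smul, add_smul, map_add, map_add, LinearMap.add_apply, hp, hq]
    | monomial m r hm =>
      intro u v
      rw [pow_succ, ← mul_assoc, map_mul, Polynomial.aeval_X, mul_smul, hm, hCfθ, ← hCfθ',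
        smul_smul, mul_comm]
  obtain ⟨φ, hφ⟩ := T.exists_φ hf hn η Cf
    (fun l u v => by
      obtain ⟨p, rfl⟩ := T.exists_aeval_eq l
      exact hadj p u v)
    (fun v hv => Matrix.eq_zero_of_mulVec_eq_zero (T.det_ne_zero h)
      (dotProduct_eq_zero _ fun u => by rw [dotProduct_comm, ← hCf, hv]))
  have hY (i j : Fin n) : T.form φ (T.mulθ (Fin n → K) (Pi.basisFun K (Fin n) i))
      (Pi.basisFun K (Fin n) j) = A i j := by
    rw [hφ]
    refine (hCfθ _ _).trans ?_
    simp
  refine exists_of_form T η h (Pi.basisFun K (Fin n)) φ ?_ ?_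
  · ext i j
    exact (T.ev_X_one_φ φ _ _).trans (hY i j)
  · ext i j
    refine (T.ev_X_zero_φ φ _ _).trans ?_
    rw [hY, hφ, hCf]
    simp [hC]

end FModule

/-! ### The bijection -/

theorem exists_basis_toMatrix_eq {n : ℕ} {M : Type*} [AddCommGroup M] [Module K M]
    (b : Module.Basis (Fin n) K M) (D : Matrix (Fin n) (Fin n) K) (hD : D.det = 1) :
    ∃ b' : Module.Basis (Fin n) K M, b.toMatrix b' = D := by
  have hD' : IsUnit D.det := by rw [hD]; exact isUnit_one
  refine ⟨b.map (Matrix.toLinearEquiv b D hD'), ?_⟩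
  have h : ⇑(b.map (Matrix.toLinearEquiv b D hD')) = fun j => Matrix.toLin b b D (b j) := by
    ext j
    rw [Module.Basis.map_apply, Matrix.toLinearEquiv_apply]
  ext i j
  rw [h, Module.Basis.toMatrix_apply, ← LinearMap.toMatrix_apply b b, LinearMap.toMatrix_toLin]

theorem Vf.orbit_eq_iff {n : ℕ} (v v' : Vf f n) :
    Vf.orbit v = Vf.orbit v' ↔ ∃ D : Matrix (Fin n) (Fin n) K, D.det = 1 ∧
      v.1.1.1 = D.transpose * v'.1.1.1 * D ∧ v.1.1.2 = D.transpose * v'.1.1.2 * D := by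
  have h : Vf.orbit v = Vf.orbit v' ↔
      ∃ g : Matrix.SpecialLinearGroup (Fin n) K, g • v' = v := by
    rw [Vf.orbit, Vf.orbit, Quotient.eq, MulAction.orbitRel_apply]
    rfl
  rw [h]
  constructor
  · rintro ⟨g, rfl⟩
    exact ⟨(g⁻¹).1, (g⁻¹).2, rfl, rfl⟩
  · rintro ⟨D, hD, h1, h2⟩
    let g : Matrix.SpecialLinearGroup (Fin n) K := ⟨D, hD⟩
    have hg : (g⁻¹)⁻¹.1 = D := by rw [inv_inv]
    refine ⟨g⁻¹, Subtype.ext (Subtype.ext (Prod.ext ?_ ?_))⟩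
    · change (g⁻¹)⁻¹.1.transpose * v'.1.1.1 * (g⁻¹)⁻¹.1 = _
      rw [hg, h1]
    · change (g⁻¹)⁻¹.1.transpose * v'.1.1.2 * (g⁻¹)⁻¹.1 = _
      rw [hg, h2]

namespace FModule

variable {n : ℕ} [Nontrivial (L f)]

/-- The pair `(A_y, A_x)` of an `f`-module with respect to a basis of volume `e`. -/
def toVf (P : FModule f n) (b : Module.Basis (Fin n) K P.M)
    (hb : exteriorPower.ιMulti K n b = P.e) : Vf f n :=
  ⟨⟨(P.Ay b, P.Ax b), P.gram_isSymm b _, P.gram_isSymm b _⟩, P.disc_eq b hb⟩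

/-- Independence of the basis, invariance under isomorphism and injectivity all come from this one
equivalence. A congruence of determinant 1 is a change of basis preserving the volume, which reduces
to equal Gram matrices. -/
theorem orbit_toVf_eq_iff (T : Trivialization f n) (hf : f.IsHomogeneous n) (hn : n ≠ 0)
    {P Q : FModule f n} {b : Module.Basis (Fin n) K P.M} {b' : Module.Basis (Fin n) K Q.M}
    (hb : exteriorPower.ιMulti K n b = P.e) (hb' : exteriorPower.ιMulti K n b' = Q.e) :
    Vf.orbit (P.toVf b hb) = Vf.orbit (Q.toVf b' hb') ↔ P.IsIso Q := by
  rw [Vf.orbit_eq_iff]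
  constructor
  · rintro ⟨D, hD, h1, h2⟩
    obtain ⟨b'', rfl⟩ := exists_basis_toMatrix_eq b' D hD
    have hb'' : exteriorPower.ιMulti K n b'' = Q.e := by
      rw [← hb']
      exact (ιMulti_eq_iff_det_eq_one b' b'').mpr hD
    refine isIso_of_gram_eq T hf hn hb hb'' ?_ ?_
    · exact h2.trans (T.gram_basis_change Q.φ b' b'' 0).symm
    · exact h1.trans (T.gram_basis_change Q.φ b' b'' 1).symm
  · rintro ⟨ψ, h1, h2⟩
    let b'' := b.map (ψ.restrictScalars K)
    have hgram (a : MvPolynomial (Fin 2) K) : gram f P.φ b a = gram f Q.φ b'' a := by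
      ext i j
      exact congrArg (ev f a) (h1 _ _).symm
    have hb'' : exteriorPower.ιMulti K n b'' = exteriorPower.ιMulti K n b' := by
      rw [hb', ← h2, ← hb, exteriorPower.map_apply_ιMulti]
      rfl
    refine ⟨b'.toMatrix b'', (ιMulti_eq_iff_det_eq_one b' b'').mp hb'', ?_, ?_⟩
    · exact (hgram _).trans (T.gram_basis_change Q.φ b' b'' 1)
    · exact (hgram _).trans (T.gram_basis_change Q.φ b' b'' 0)

end FModule

end BinaryForm

end
-- Assembly of the bijection.
theorem mainTheorem9 {K : Type*} [Field K] [CharZero K] {n : ℕ} (hn : 2 ≤ n)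
    (f : MvPolynomial (Fin 2) K) (hf : f.IsHomogeneous n) (hdisc : BinaryForm.DiscrNeZero f n) :
    ∃ Φ : BinaryForm.FModule.IsoClass f n → BinaryForm.Orbits f n,
      Function.Bijective Φ ∧
        ∀ P : BinaryForm.FModule f n,
          (∃ b : Module.Basis (Fin n) K P.M, exteriorPower.ιMulti K n b = P.e) ∧
            ∀ b : Module.Basis (Fin n) K P.M, exteriorPower.ιMulti K n b = P.e →
              ∃ (hs : (P.Ay b).IsSymm ∧ (P.Ax b).IsSymm)
                (hv : (⟨(P.Ay b, P.Ax b), hs⟩ : BinaryForm.SymPair K n) ∈ BinaryForm.Vf f n),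
                Φ P.isoClass = BinaryForm.Vf.orbit ⟨⟨(P.Ay b, P.Ax b), hs⟩, hv⟩ := by
  have hn0 : n ≠ 0 := by omega
  obtain ⟨T⟩ := BinaryForm.exists_trivialization hn hf (hdisc.ne_zero hn)
  have : Nontrivial (BinaryForm.L f) :=
    Module.nontrivial_of_finrank_pos (R := K) (by rw [T.finrank_L hf hn0]; omega)
  have hex (P : BinaryForm.FModule f n) := BinaryForm.FModule.exists_basis (P := P) T hf hn0
  choose β hβ using hex
  have hiff {P Q : BinaryForm.FModule f n} {b : Module.Basis (Fin n) K P.M}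
      {b' : Module.Basis (Fin n) K Q.M} (hb : exteriorPower.ιMulti K n b = P.e)
      (hb' : exteriorPower.ιMulti K n b' = Q.e) :=
    BinaryForm.FModule.orbit_toVf_eq_iff T hf hn0 hb hb'
  -- The orbit is computed in a chosen basis; `hΦ` then removes the choice, by comparing P with
  -- itself.
  let Φ : BinaryForm.FModule.IsoClass f n → BinaryForm.Orbits f n :=
    Quotient.lift (fun P => BinaryForm.Vf.orbit (P.toVf (β P) (hβ P)))
      fun P Q h => (hiff (hβ P) (hβ Q)).mpr h
  have hΦ (P : BinaryForm.FModule f n) (b : Module.Basis (Fin n) K P.M)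
      (hb : exteriorPower.ιMulti K n b = P.e) :
      Φ P.isoClass = BinaryForm.Vf.orbit (P.toVf b hb) :=
    (hiff (hβ P) hb).mpr ((BinaryForm.FModule.isoSetoid f n).refl P)
  refine ⟨Φ, ⟨?_, ?_⟩, fun P => ⟨⟨β P, hβ P⟩, fun b hb => ⟨_, _, hΦ P b hb⟩⟩⟩
  · rintro ⟨P⟩ ⟨Q⟩ h
    exact Quotient.sound ((hiff (hβ P) (hβ Q)).mp h)
  · rintro ⟨v⟩
    obtain ⟨P, b, hb, hA, hB⟩ := BinaryForm.FModule.exists_of_mem_Vf T hf hn0 hdisc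
      v.1.2.1 v.1.2.2 v.2
    refine ⟨P.isoClass, (hΦ P b hb).trans ?_⟩
    exact congrArg BinaryForm.Vf.orbit (Subtype.ext (Subtype.ext (Prod.ext hA hB)))
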